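/- Let $Q_n$ denote the $n$-cube, i.e. the graph on $\{0,1\}^n$ in which two sequences are adjacent iff they differ in exactly one coordinate. A $d$-subcube of $Q_n$ is a set $C\subseteq\{0,1\}^n$ whose induced subgraph $Q_n[C]$ is isomorphic to $Q_d$; there are exactly $\binom nd 2^{n-d}$ of them. For $H\subseteq\{0,1\}^d$ and $S\subseteq\{0,1\}^n$, a $d$-subcube $C$ gives a copy of $H$ in $S$ if there is a graph isomorphism $f$ from $Q_d$ to $Q_n[C]$ with $f(H)=S\cap C$. Let $\Lambda(H,S)$ be the number of $d$-subcubes $C$ that give a copy of $H$ in $S$, let $\Lambda(H,n)=\max\{\Lambda(H,S) : S\subseteq\{0,1\}^n\}$, and let the inducibility constant of $H$ be $$\lambda(H)=\lim_{n\to\infty}\frac{\Lambda(H,n)}{\binom nd\,2^{n-d}}.$$ Consider the following subsets of $\{0,1\}^3$: \begin{align*} W_7&=\{(0,0,0),(1,1,1)\},\\ W_8&=\{(0,0,1),(0,1,0),(1,0,0)\},\\ W_9&=\{(0,0,0),(0,0,1),(0,1,0),(1,1,1)\},\\ W_{10}&=\{(0,0,0),(0,0,1),(1,1,1)\},\\ W_{12}&=\{(0,0,0),(0,0,1),(0,1,0),(1,0,0)\}.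 \end{align*} Then the limits defining the inducibility constants of these five configurations exist, and $$\lambda(W_7)=\tfrac13,\qquad \lambda(W_8)=\tfrac23,\qquad \lambda(W_9)=\tfrac49,\qquad \lambda(W_{10})=\tfrac5{12},\qquad \lambda(W_{12})=\tfrac12.$$ -/

import Mathlib

namespace Hypercube

/-- The `n`-cube `Q_n`: the graph on binary sequences of length `n` in which two sequences are
adjacent iff they differ in exactly one coordinate. -/
def cube (n : ℕ) : SimpleGraph (Fin n → Fin 2) where
  Adj x y := hammingDist x y = 1
  symm := ⟨fun x y h => by rw [hammingDist_comm]; exact h⟩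
  loopless := ⟨fun x h => by simp at h⟩

/-- `C` is a `d`-subcube of `Q_n` that gives a copy of `H ⊆ {0,1}^d` in `S ⊆ {0,1}^n`: there is a
graph isomorphism `f` from `Q_d` to the subgraph of `Q_n` induced by `C` with `f(H) = S ∩ C`. -/
def GivesCopy {d n : ℕ} (H : Set (Fin d → Fin 2)) (S C : Set (Fin n → Fin 2)) : Prop :=
  ∃ f : cube d ≃g (cube n).induce C, (fun x => (f x : Fin n → Fin 2)) '' H = S ∩ C

/-- `Λ(H, S)`: the number of copies of `H` in `S`, that is, the number of vertex sets `C` of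
`d`-subcubes giving a copy of `H` in `S`. -/
noncomputable def copyCount {d n : ℕ} (H : Set (Fin d → Fin 2)) (S : Set (Fin n → Fin 2)) : ℕ :=
  {C : Set (Fin n → Fin 2) | GivesCopy H S C}.ncard

/-- The inducibility function `Λ(H, n)`: the maximum of `Λ(H, S)` over all `S ⊆ {0,1}^n`. -/
noncomputable def inducibility {d : ℕ} (H : Set (Fin d → Fin 2)) (n : ℕ) : ℕ :=
  (Finset.univ : Finset (Finset (Fin n → Fin 2))).sup
    fun S => copyCount H (S : Set (Fin n → Fin 2))

/-- The inducibility constant `λ(H)`, as a relation: the ratio of `Λ(H, n)` to the number of all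
`d`-subcubes of `Q_n` converges to `c` as `n → ∞`. -/
def HasInducibilityConstant {d : ℕ} (H : Set (Fin d → Fin 2)) (c : ℝ) : Prop :=
  Filter.Tendsto
    (fun n : ℕ => (inducibility H n : ℝ) / ((n.choose d : ℝ) * 2 ^ (n - d)))
    Filter.atTop (nhds c)

def W7 : Set (Fin 3 → Fin 2) := {![0, 0, 0], ![1, 1, 1]}

def W8 : Set (Fin 3 → Fin 2) := {![0, 0, 1], ![0, 1, 0], ![1, 0, 0]}

def W9 : Set (Fin 3 → Fin 2) := {![0, 0, 0], ![0, 0, 1], ![0, 1, 0], ![1, 1, 1]}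

def W10 : Set (Fin 3 → Fin 2) := {![0, 0, 0], ![0, 0, 1], ![1, 1, 1]}

def W12 : Set (Fin 3 → Fin 2) := {![0, 0, 0], ![0, 0, 1], ![0, 1, 0], ![1, 0, 0]}

end Hypercube

/-! Copies are counted through frames: a base vertex `x` together with three distinct directions
`d`. A subcube giving a copy of `H` carries exactly as many frames along which `S` looks like `H` as
`H` has symmetries (`card_frames`). So the constant is 48 / |Stab(H)| times the limiting maximal
density of such frames among the 2^n n^3 pairs `(x, d)`.

Upper bounds are sums of squares, as in flag algebras. With the base vertex and all directions but
one fixed, summing `q * q'` over two independent choices of the remaining direction gives a square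
(`sum_frames_mul_nonneg`). Directions are allowed to coincide, so these are exact squares and no
error term appears. Adding suitable squares to the indicator of `H` gives a function of the 256
patterns on Q_3 whose average over the 48 symmetries never exceeds the claimed density; this is a
finite check. For `W8` the squares are rooted at a 2-face and live on Q_4.

Lower bounds come from a finite abelian group `G` and a subset `A`. Each coordinate receives a
random weight in `G` and a random reflection, and `S` consists of the vertices whose total weight,
plus a random shift, lies in `A`. The law of the pattern on a 3-subcube does not depend on n, so the
expected density is a count inside `G`, and some choice attains it (`exists_card_frames_ge`). The
two densities agree, and n^3 ~ n(n-1)(n-2) closes the squeeze. -/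

namespace Hypercube

open Finset

/-! ### Frames in the cube -/

/-- The vertex of `Q_n` reached from `x` by flipping, for each `a` with `v a = 1`, the
coordinate `d a`. -/
def vtx {n N : ℕ} (x : Fin n → Fin 2) (d : Fin N → Fin n) (v : Fin N → Fin 2) : Fin n → Fin 2 :=
  x + ∑ a, Pi.single (d a) (v a)

section Frames

variable {n N : ℕ}

theorem fin_two_add_self {n : ℕ} (x : Fin n → Fin 2) : x + x = 0 := by
  funext i
  have : ∀ t : Fin 2, t + t = 0 := by decide
  exact this _

@[simp] theorem vtx_zero (x : Fin n → Fin 2) (d : Fin N → Fin n) : vtx x d 0 = x := by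
  simp [vtx]

theorem vtx_add (x : Fin n → Fin 2) (d : Fin N → Fin n) (u v : Fin N → Fin 2) :
    vtx x d (u + v) = vtx (vtx x d u) d v := by
  simp [vtx, Pi.single_add, Finset.sum_add_distrib, add_assoc]

theorem vtx_comp_perm (x : Fin n → Fin 2) (d : Fin N → Fin n) (π : Equiv.Perm (Fin N))
    (v : Fin N → Fin 2) : vtx x (d ∘ π) v = vtx x d (v ∘ π.symm) := by
  unfold vtx
  congr 1
  exact Fintype.sum_equiv π _ _ fun a => by simp

theorem vtx_single (x : Fin n → Fin 2) (d : Fin N → Fin n) (a : Fin N) :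
    vtx x d (Pi.single a 1) = x + Pi.single (d a) 1 := by
  unfold vtx
  congr 1
  rw [Finset.sum_eq_single a]
  · simp
  · intro b _ hb
    simp [Pi.single_eq_of_ne hb]
  · simp

theorem vtx_apply (x : Fin n → Fin 2) {d : Fin N → Fin n} (hd : Function.Injective d)
    (v : Fin N → Fin 2) (a : Fin N) : vtx x d v (d a) = x (d a) + v a := by
  simp only [vtx, Pi.add_apply, Finset.sum_apply]
  congr 1
  rw [Finset.sum_eq_single a]
  · simp
  · intro b _ hb
    exact Pi.single_eq_of_ne (fun h => hb (hd h).symm) _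
  · simp

theorem vtx_apply_of_notMem (x : Fin n → Fin 2) {d : Fin N → Fin n}
    (v : Fin N → Fin 2) {i : Fin n} (hi : ∀ a, d a ≠ i) : vtx x d v i = x i := by
  simp only [vtx, Pi.add_apply, Finset.sum_apply]
  rw [Finset.sum_eq_zero, add_zero]
  intro a _
  exact Pi.single_eq_of_ne (hi a).symm _

theorem vtx_injective (x : Fin n → Fin 2) {d : Fin N → Fin n} (hd : Function.Injective d) :
    Function.Injective (vtx x d) := by
  intro v w h
  funext a
  have := congrFun h (d a)
  rw [vtx_apply x hd, vtx_apply x hd] at this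
  exact add_left_cancel this

theorem hammingDist_vtx (x : Fin n → Fin 2) {d : Fin N → Fin n} (hd : Function.Injective d)
    (v w : Fin N → Fin 2) : hammingDist (vtx x d v) (vtx x d w) = hammingDist v w := by
  unfold hammingDist
  rw [← Finset.card_image_of_injective _ hd]
  congr 1
  ext i
  simp only [Finset.mem_filter, Finset.mem_univ, true_and, Finset.mem_image]
  by_cases hi : ∃ a, d a = i
  · obtain ⟨a, rfl⟩ := hi
    rw [vtx_apply x hd, vtx_apply x hd]
    constructor
    · intro h
      exact ⟨a, fun h' => h (by rw [h']), rfl⟩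
    · rintro ⟨b, hb, hba⟩
      rw [hd hba] at hb
      exact fun h => hb (add_left_cancel h)
  · push Not at hi
    rw [vtx_apply_of_notMem x v hi, vtx_apply_of_notMem x w hi]
    constructor
    · intro h
      exact absurd rfl h
    · rintro ⟨b, _, hba⟩
      exact absurd hba (hi b)

theorem cube_adj_iff {x y : Fin n → Fin 2} :
    (cube n).Adj x y ↔ ∃ i, y = x + Pi.single i 1 := by
  change hammingDist x y = 1 ↔ _
  have key : ∀ s t : Fin 2, s ≠ t → t = s + 1 := by decide
  unfold hammingDist
  rw [Finset.card_eq_one]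
  constructor
  · rintro ⟨i, hi⟩
    refine ⟨i, ?_⟩
    funext j
    have hj := Finset.ext_iff.1 hi j
    simp only [Finset.mem_filter, Finset.mem_univ, true_and, Finset.mem_singleton] at hj
    by_cases h : j = i
    · subst h
      simpa using key _ _ (hj.2 rfl)
    · have : x j = y j := by
        by_contra h'
        exact h (hj.1 h')
      simp [Pi.single_eq_of_ne h, this]
  · rintro ⟨i, rfl⟩
    refine ⟨i, ?_⟩
    ext j
    simp only [Finset.mem_filter, Finset.mem_univ, true_and, Finset.mem_singleton]
    by_cases h : j = i
    · subst h
      simp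
    · simp [h]

/-- Two vertices at distance two have exactly two common neighbours. -/
theorem eq_of_adj_of_adj {x y : Fin n → Fin 2} {i j : Fin n} (hij : i ≠ j)
    (hi : (cube n).Adj (x + Pi.single i 1) y) (hj : (cube n).Adj (x + Pi.single j 1) y)
    (hy : y ≠ x) : y = x + Pi.single i 1 + Pi.single j 1 := by
  obtain ⟨k, rfl⟩ := cube_adj_iff.1 hi
  obtain ⟨l, hl⟩ := cube_adj_iff.1 hj
  have hki : k ≠ i := by
    rintro rfl
    apply hy
    rw [add_assoc, fin_two_add_self, add_zero]
  have h1 := congrFun hl k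
  by_cases hkj : k = j
  · rw [hkj]
  · exfalso
    have h2 := congrFun hl i
    simp only [Pi.add_apply, Pi.single_eq_same, Pi.single_eq_of_ne hki, Pi.single_eq_of_ne hkj,
      Pi.single_eq_of_ne hki.symm, Pi.single_eq_of_ne hij, add_zero,
      add_right_inj, Pi.single_apply] at h1 h2
    split_ifs at h1 h2 with a b
    · exact hki (a.trans b.symm)
    all_goals simp at h1 h2

/-- An embedding is determined by the images of 0 and the unit vectors: every later vertex is the
second common neighbour of two vertices already placed. -/
theorem exists_frame_of_embedding (F : (Fin 3 → Fin 2) → (Fin n → Fin 2))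
    (hF : Function.Injective F) (hadj : ∀ v w, (cube 3).Adj v w → (cube n).Adj (F v) (F w)) :
    ∃ d : Fin 3 → Fin n, Function.Injective d ∧ F = vtx (F 0) d := by
  have h1 : ∀ a : Fin 3, ∃ i, F (Pi.single a 1) = F 0 + Pi.single i 1 := fun a =>
    cube_adj_iff.1 (hadj _ _ (cube_adj_iff.2 ⟨a, by simp⟩))
  choose d hd using h1
  have hinj : Function.Injective d := by
    intro a b hab
    have : F (Pi.single a 1) = F (Pi.single b 1) := by rw [hd, hd, hab]
    have h := congrFun (hF this) a
    by_contra hne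
    rw [Pi.single_eq_same, Pi.single_eq_of_ne hne] at h
    simp at h
  have h2 : ∀ a b : Fin 3, a ≠ b →
      F (Pi.single a 1 + Pi.single b 1) = F 0 + Pi.single (d a) 1 + Pi.single (d b) 1 := by
    intro a b hab
    refine eq_of_adj_of_adj (fun h => hab (hinj h)) ?_ ?_ ?_
    · rw [← hd]
      exact hadj _ _ (cube_adj_iff.2 ⟨b, rfl⟩)
    · rw [← hd]
      exact hadj _ _ (cube_adj_iff.2 ⟨a, add_comm _ _⟩)
    · intro h
      have h := congrFun (hF h) a
      simp [Pi.single_eq_of_ne hab] at h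
  have h3 : F (Pi.single 0 1 + Pi.single 1 1 + Pi.single 2 1) =
      F 0 + Pi.single (d 0) 1 + Pi.single (d 1) 1 + Pi.single (d 2) 1 := by
    -- The antipode is the common neighbour of the images of e₀ + e₁ and e₀ + e₂ other than the
    -- image of e₀.
    refine eq_of_adj_of_adj (fun h => absurd (hinj h) (by decide)) ?_ ?_ ?_
    · rw [← h2 0 1 (by decide)]
      exact hadj _ _ (cube_adj_iff.2 ⟨2, rfl⟩)
    · rw [← h2 0 2 (by decide)]
      exact hadj _ _ (cube_adj_iff.2 ⟨1, by abel⟩)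
    · rw [← hd]
      intro h
      have h := congrFun (hF h) 1
      simp at h
  refine ⟨d, hinj, ?_⟩
  have hs : ∀ v : Fin 3 → Fin 2, v = 0 ∨ (∃ a, v = Pi.single a 1) ∨
      (∃ a b, a ≠ b ∧ v = Pi.single a 1 + Pi.single b 1) ∨
      v = Pi.single 0 1 + Pi.single 1 1 + Pi.single 2 1 := by decide
  funext v
  rcases hs v with rfl | ⟨a, rfl⟩ | ⟨a, b, hab, rfl⟩ | rfl
  · simp
  · rw [hd, vtx_single]
  · rw [h2 a b hab, vtx_add, vtx_single, vtx_single]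
  · rw [h3, vtx_add, vtx_add, vtx_single, vtx_single, vtx_single]

/-- Frames with the same range differ by a symmetry of the cube. -/
theorem exists_perm_of_range_eq {x x' : Fin n → Fin 2} {d d' : Fin N → Fin n}
    (hd' : Function.Injective d')
    (h : Set.range (vtx x' d') = Set.range (vtx x d)) :
    ∃ (u : Fin N → Fin 2) (π : Equiv.Perm (Fin N)), x' = vtx x d u ∧ d' = d ∘ π := by
  obtain ⟨u, hu⟩ : x' ∈ Set.range (vtx x d) := h ▸ ⟨0, vtx_zero _ _⟩
  have hmem : ∀ a, ∃ b, d b = d' a := by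
    intro a
    by_contra hne
    push Not at hne
    obtain ⟨w, hw⟩ : vtx x' d' (Pi.single a 1) ∈ Set.range (vtx x d) := h ▸ ⟨_, rfl⟩
    have h1 := congrFun hw (d' a)
    have h2 := congrFun hu (d' a)
    rw [vtx_apply x' hd', vtx_apply_of_notMem x w hne] at h1
    rw [vtx_apply_of_notMem x u hne] at h2
    rw [h2] at h1
    simp at h1
  choose f hf using hmem
  have hfi : Function.Injective f := fun a b hab => hd' (by rw [← hf, ← hf, hab])
  exact ⟨u, Equiv.ofBijective f (Finite.injective_iff_bijective.1 hfi), hu.symm,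
    funext fun a => (hf a).symm⟩

theorem range_vtx_symm (x : Fin n → Fin 2) (d : Fin N → Fin n) (u : Fin N → Fin 2)
    (π : Equiv.Perm (Fin N)) :
    Set.range (vtx (vtx x d u) (d ∘ π)) = Set.range (vtx x d) := by
  ext y
  constructor
  · rintro ⟨v, rfl⟩
    exact ⟨u + v ∘ π.symm, by rw [vtx_comp_perm, vtx_add]⟩
  · rintro ⟨v, rfl⟩
    refine ⟨(u + v) ∘ π, ?_⟩
    rw [vtx_comp_perm, ← vtx_add]
    have hc : ((u + v) ∘ π) ∘ π.symm = u + v := by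
      funext a
      simp
    rw [hc, ← add_assoc, fin_two_add_self, zero_add]

end Frames

/-! ### Counting copies by frames -/

section Count

variable {n N : ℕ}

open Classical in
/-- The injective frames in `Q_n` along which `S` looks exactly like `H`. -/
noncomputable def frames (H : Set (Fin N → Fin 2)) (S : Set (Fin n → Fin 2)) :
    Finset ((Fin n → Fin 2) × (Fin N → Fin n)) :=
  univ.filter fun p => Function.Injective p.2 ∧ ∀ v, vtx p.1 p.2 v ∈ S ↔ v ∈ H

open Classical in
/-- The symmetries of the cube that preserve `H`. -/
noncomputable def stabilizer (H : Set (Fin N → Fin 2)) :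
    Finset ((Fin N → Fin 2) × Equiv.Perm (Fin N)) :=
  univ.filter fun σ => ∀ v, σ.1 + v ∘ σ.2.symm ∈ H ↔ v ∈ H

theorem mem_frames {H : Set (Fin N → Fin 2)} {S : Set (Fin n → Fin 2)}
    {p : (Fin n → Fin 2) × (Fin N → Fin n)} :
    p ∈ frames H S ↔ Function.Injective p.2 ∧ ∀ v, vtx p.1 p.2 v ∈ S ↔ v ∈ H := by
  simp [frames]

theorem mem_stabilizer {H : Set (Fin N → Fin 2)} {σ : (Fin N → Fin 2) × Equiv.Perm (Fin N)} :
    σ ∈ stabilizer H ↔ ∀ v, σ.1 + v ∘ σ.2.symm ∈ H ↔ v ∈ H := by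
  simp [stabilizer]

theorem givesCopy_iff {H : Set (Fin 3 → Fin 2)} {S C : Set (Fin n → Fin 2)} :
    GivesCopy H S C ↔ ∃ p ∈ frames H S, Set.range (vtx p.1 p.2) = C := by
  constructor
  · rintro ⟨f, hf⟩
    obtain ⟨d, hd, hF⟩ := exists_frame_of_embedding (fun v => (f v : Fin n → Fin 2))
      (fun v w h => f.injective (Subtype.ext h))
      (fun v w h => by simpa using (f.map_adj_iff (v := v) (w := w)).2 h)
    have hv : ∀ v, vtx (f 0 : Fin n → Fin 2) d v = f v := fun v => (congrFun hF v).symm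
    refine ⟨(f 0, d), mem_frames.2 ⟨hd, fun v => ?_⟩, ?_⟩
    · change vtx (f 0 : Fin n → Fin 2) d v ∈ S ↔ _
      rw [hv]
      constructor
      · intro h
        have : (f v : Fin n → Fin 2) ∈ S ∩ C := ⟨h, (f v).2⟩
        rw [← hf] at this
        obtain ⟨w, hw, hwv⟩ := this
        rwa [← f.injective (Subtype.ext hwv)]
      · intro h
        have : (f v : Fin n → Fin 2) ∈ S ∩ C := hf ▸ ⟨v, h, rfl⟩
        exact this.1
    · ext y
      constructor
      · rintro ⟨v, rfl⟩
        rw [hv]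
        exact (f v).2
      · intro hy
        obtain ⟨v, hv'⟩ := f.surjective ⟨y, hy⟩
        exact ⟨v, by rw [hv, hv']⟩
  · rintro ⟨⟨x, d⟩, hp, rfl⟩
    obtain ⟨hd, hS⟩ := mem_frames.1 hp
    refine ⟨⟨Equiv.ofInjective (vtx x d) (vtx_injective x hd), ?_⟩, ?_⟩
    · intro v w
      change hammingDist (vtx x d v) (vtx x d w) = 1 ↔ hammingDist v w = 1
      rw [hammingDist_vtx x hd]
    · ext y
      constructor
      · rintro ⟨v, hv, rfl⟩
        exact ⟨(hS v).2 hv, v, rfl⟩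
      · rintro ⟨hy, v, rfl⟩
        exact ⟨v, (hS v).1 hy, rfl⟩

open Classical in
theorem copyCount_eq_card_image (H : Set (Fin 3 → Fin 2)) (S : Set (Fin n → Fin 2)) :
    copyCount H S = ((frames H S).image fun p => Set.range (vtx p.1 p.2)).card := by
  unfold copyCount
  rw [← Set.ncard_coe_finset]
  congr 1
  ext C
  simp only [Set.mem_ofPred_eq, givesCopy_iff, Finset.coe_image, Set.mem_image, Finset.mem_coe]

/-- Orbit counting: two frames of the same subcube differ by a unique symmetry of Q_3, and both show
`H` exactly when that symmetry preserves `H`. -/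
theorem card_frames (H : Set (Fin 3 → Fin 2)) (S : Set (Fin n → Fin 2)) :
    (frames H S).card = (stabilizer H).card * copyCount H S := by
  classical
  rw [copyCount_eq_card_image, mul_comm,
    Finset.card_eq_sum_card_image (fun p => Set.range (vtx p.1 p.2)) (frames H S),
    Finset.sum_const_nat]
  intro C hC
  obtain ⟨⟨x, d⟩, hp, rfl⟩ := Finset.mem_image.1 hC
  obtain ⟨hd, hS⟩ := mem_frames.1 hp
  dsimp only at hd hS
  symm
  refine Finset.card_bij (fun σ _ => (vtx x d σ.1, d ∘ σ.2)) ?_ ?_ ?_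
  · rintro ⟨u, π⟩ hσ
    rw [mem_stabilizer] at hσ
    refine Finset.mem_filter.2 ⟨mem_frames.2 ⟨hd.comp π.injective, fun v => ?_⟩,
      range_vtx_symm x d u π⟩
    rw [← hσ v, ← hS, vtx_add, ← vtx_comp_perm]
  · rintro ⟨u, π⟩ _ ⟨u', π'⟩ _ h
    rw [Prod.mk.injEq] at h ⊢
    refine ⟨vtx_injective x hd h.1, Equiv.ext fun a => hd (congrFun h.2 a)⟩
  · rintro ⟨x', d'⟩ h
    rw [Finset.mem_filter, mem_frames] at h
    obtain ⟨⟨hd', hS'⟩, hr⟩ := h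
    obtain ⟨u, π, rfl, rfl⟩ := exists_perm_of_range_eq hd' hr
    refine ⟨(u, π), mem_stabilizer.2 fun v => ?_, rfl⟩
    rw [← hS' v, ← hS, vtx_add, ← vtx_comp_perm]

end Count

/-! ### Averaging over frames -/

section Averaging

variable {n N : ℕ}

/-- A frame inside a frame is again a frame. Neither direction map needs to be injective, so
degenerate frames are covered. -/
theorem vtx_vtx (x : Fin n → Fin 2) (d : Fin N → Fin n) {M : ℕ} (u : Fin N → Fin 2)
    (p : Fin M → Fin N) (v : Fin M → Fin 2) :
    vtx x d (vtx u p v) = vtx (vtx x d u) (d ∘ p) v := by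
  have h : vtx u p v = u + vtx 0 p v := by simp [vtx]
  rw [h, vtx_add]
  unfold vtx
  congr 1
  simp only [zero_add, Finset.sum_apply]
  have hs : ∀ b a, (Pi.single (d b) ((Pi.single (p a) (v a) : Fin N → Fin 2) b) :
      Fin n → Fin 2) = if b = p a then Pi.single (d (p a)) (v a) else 0 := by
    intro b a
    split_ifs with hb
    · subst hb
      simp
    · simp [Pi.single_eq_of_ne hb]
  have hsum : ∀ b, (Pi.single (d b) (∑ a, (Pi.single (p a) (v a) : Fin N → Fin 2) b) :
      Fin n → Fin 2) =
      ∑ a, Pi.single (d b) ((Pi.single (p a) (v a) : Fin N → Fin 2) b) := fun b =>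
    map_sum (AddMonoidHom.single (fun _ : Fin n => Fin 2) (d b)) _ _
  simp only [hsum, hs]
  rw [Finset.sum_comm]
  simp

/-- Reparametrizing all frames by a symmetry of `Q_N` does not change a sum over them. -/
theorem sum_frames_symm {M : Type*} [AddCommMonoid M] (f : ((Fin N → Fin 2) → Bool) → M)
    (s : (Fin n → Fin 2) → Bool)
    (u : Fin N → Fin 2) {p : Fin N → Fin N} (hp : Function.Injective p) :
    ∑ d : Fin N → Fin n, ∑ x, f (s ∘ vtx x d ∘ vtx u p) =
      ∑ d : Fin N → Fin n, ∑ x, f (s ∘ vtx x d) := by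
  refine Fintype.sum_equiv (Equiv.arrowCongr
    (Equiv.ofBijective p (Finite.injective_iff_bijective.1 hp)).symm (Equiv.refl _)) _ _ ?_
  intro d
  refine Fintype.sum_equiv (Equiv.addRight (∑ a, Pi.single (d a) (u a))) _ _ ?_
  intro x
  congr 1
  funext v
  simp only [Function.comp_apply, vtx_vtx]
  rfl

/-- Frames sharing all but their first direction: the sum of squares. -/
theorem sum_frames_mul_nonneg {k : ℕ} (q : ((Fin (k + 1) → Fin 2) → Bool) → ℤ)
    (s : (Fin n → Fin 2) → Bool) :
    0 ≤ ∑ d : Fin (k + 2) → Fin n, ∑ x, q ((s ∘ vtx x d) ∘ vtx 0 Fin.succ) *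
      q ((s ∘ vtx x d) ∘ vtx 0 (Fin.succAbove 1)) := by
  have h : ∀ (d : Fin (k + 2) → Fin n) (x) (p : Fin (k + 1) → Fin (k + 2)),
      (s ∘ vtx x d) ∘ vtx 0 p = s ∘ vtx x (d ∘ p) := by
    intro d x p
    funext v
    simp [vtx_vtx]
  simp only [h]
  rw [Finset.sum_comm]
  refine Finset.sum_nonneg fun x _ => ?_
  -- Split off directions 0 and 1: one factor ignores direction 0 and the other ignores direction 1,
  -- so for fixed remaining directions `D` the double sum factors into a square.
  rw [← (Fin.consEquiv fun _ => Fin n).sum_comp, Fintype.sum_prod_type, Finset.sum_comm]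
  rw [← (Fin.consEquiv fun _ => Fin n).sum_comp, Fintype.sum_prod_type, Finset.sum_comm]
  refine Finset.sum_nonneg fun D _ => ?_
  have h1 : ∀ e e' : Fin n, (Fin.cons e (Fin.cons e' D : Fin (k + 1) → Fin n) :
      Fin (k + 2) → Fin n) ∘ Fin.succ = Fin.cons e' D := by
    intro e e'
    funext i
    simp
  have h2 : ∀ e e' : Fin n, (Fin.cons e (Fin.cons e' D : Fin (k + 1) → Fin n) :
      Fin (k + 2) → Fin n) ∘ Fin.succAbove 1 = Fin.cons e D := by
    intro e e'
    funext i
    refine Fin.cases ?_ (fun j => ?_) i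
    · simp
    · have : (Fin.succAbove 1 j.succ : Fin (k + 2)) = j.succ.succ := by
        rw [← Fin.succ_zero_eq_one, Fin.succ_succAbove_succ, Fin.succAbove_zero]
      simp [this]
  simp only [Fin.consEquiv, Equiv.coe_fn_mk, h1, h2]
  rw [← Finset.sum_mul_sum]
  exact mul_self_nonneg _

end Averaging

/-! ### Binary codes of vertices and patterns -/

section Codes

/-- The vertex of `Q_N` with binary code `c`. -/
def dec (N c : ℕ) : Fin N → Fin 2 := fun i => if c.testBit i then 1 else 0

theorem dec_surj (N : ℕ) (v : Fin N → Fin 2) : ∃ c < 2 ^ N, dec N c = v := by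
  refine ⟨Nat.ofBits fun i => v i = 1, Nat.ofBits_lt_two_pow _, ?_⟩
  funext i
  have : ∀ t : Fin 2, (if t = 1 then 1 else 0) = t := by decide
  simp [dec, Nat.testBit_ofBits_lt, this]

end Codes

/-! ### Certificates on three-dimensional cubes -/

section ThreeCube

/-- Functions of the eight values of a pattern on `Q_3`, listed by binary code. -/
abbrev Fun8 := Bool → Bool → Bool → Bool → Bool → Bool → Bool → Bool → ℕ

def symFlip0 (F : Fun8) : Fun8 := fun b0 b1 b2 b3 b4 b5 b6 b7 =>
  Nat.add (F b0 b1 b2 b3 b4 b5 b6 b7) (F b1 b0 b3 b2 b5 b4 b7 b6)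

def symFlip1 (F : Fun8) : Fun8 := fun b0 b1 b2 b3 b4 b5 b6 b7 =>
  Nat.add (F b0 b1 b2 b3 b4 b5 b6 b7) (F b2 b3 b0 b1 b6 b7 b4 b5)

def symFlip2 (F : Fun8) : Fun8 := fun b0 b1 b2 b3 b4 b5 b6 b7 =>
  Nat.add (F b0 b1 b2 b3 b4 b5 b6 b7) (F b4 b5 b6 b7 b0 b1 b2 b3)

def symSwap (F : Fun8) : Fun8 := fun b0 b1 b2 b3 b4 b5 b6 b7 =>
  Nat.add (F b0 b1 b2 b3 b4 b5 b6 b7) (F b0 b2 b1 b3 b4 b6 b5 b7)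

def symRot (F : Fun8) : Fun8 := fun b0 b1 b2 b3 b4 b5 b6 b7 =>
  Nat.add (F b0 b1 b2 b3 b4 b5 b6 b7) (Nat.add (F b0 b4 b2 b6 b1 b5 b3 b7) (F b0 b1 b4 b5 b2 b3 b6
    b7))

/-- The sum of a function over all forty-eight symmetries of `Q_3`. -/
def symm8 (F : Fun8) : Fun8 := symRot (symSwap (symFlip2 (symFlip1 (symFlip0 F))))

/-- A weighted square: the type of its root edge, and its values on the four flags. -/
structure Square where
  weight : ℕ
  root : Bool × Bool
  val : ℤ × ℤ × ℤ × ℤ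

def Square.eval (Q : Square) (t₀ t₁ f₀ f₁ : Bool) : ℤ :=
  cond ((t₀ == Q.root.1) && (t₁ == Q.root.2))
    (cond f₁ (cond f₀ Q.val.2.2.2 Q.val.2.2.1) (cond f₀ Q.val.2.1 Q.val.1)) 0

def matches8 (mask : ℕ) (b0 b1 b2 b3 b4 b5 b6 b7 : Bool) : Bool :=
  (b0 == mask.testBit 0) && (b1 == mask.testBit 1) && (b2 == mask.testBit 2) &&
  (b3 == mask.testBit 3) && (b4 == mask.testBit 4) && (b5 == mask.testBit 5) &&
  (b6 == mask.testBit 6) && (b7 == mask.testBit 7)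

/-- The value of a certificate on a pattern, shifted by `C` to be a natural number. -/
def certValue (mask A C : ℕ) (Qs : List Square) : Fun8 := fun b0 b1 b2 b3 b4 b5 b6 b7 =>
  ((cond (matches8 mask b0 b1 b2 b3 b4 b5 b6 b7) (A : ℤ) 0) + C +
    (Qs.map fun Q => (Q.weight : ℤ) * (Q.eval b0 b4 b2 b6 * Q.eval b0 b4 b1 b5)).sum).toNat

def all8 (p : Bool → Bool → Bool → Bool → Bool → Bool → Bool → Bool → Bool) : Bool :=
  let l := [false, true]
  l.all fun b0 => l.all fun b1 => l.all fun b2 => l.all fun b3 => l.all fun b4 => l.all fun b5 =>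
    l.all fun b6 => l.all fun b7 => p b0 b1 b2 b3 b4 b5 b6 b7

def certCheck (F : Fun8) (K : ℕ) : Bool :=
  all8 fun b0 b1 b2 b3 b4 b5 b6 b7 => Nat.ble (symm8 F b0 b1 b2 b3 b4 b5 b6 b7) K

/-- A function of eight values, applied to a pattern on `Q_3`. -/
def of8 (F : Fun8) (T : (Fin 3 → Fin 2) → Bool) : ℕ :=
  F (T (dec 3 0)) (T (dec 3 1)) (T (dec 3 2)) (T (dec 3 3)) (T (dec 3 4)) (T (dec 3 5))
    (T (dec 3 6)) (T (dec 3 7))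

variable {n : ℕ}

/-- The sum of a function of patterns over all frames. -/
def total8 (F : Fun8) (s : (Fin n → Fin 2) → Bool) : ℕ :=
  ∑ d : Fin 3 → Fin n, ∑ x, of8 F (s ∘ vtx x d)

theorem of8_comp_vtx {u : Fin 3 → Fin 2} {p : Fin 3 → Fin 3} {f : Fin 8 → ℕ}
    (h : ∀ c : Fin 8, vtx u p (dec 3 c) = dec 3 (f c)) (F : Fun8)
    (T : (Fin 3 → Fin 2) → Bool) :
    of8 F (T ∘ vtx u p) = F (T (dec 3 (f 0))) (T (dec 3 (f 1))) (T (dec 3 (f 2)))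
      (T (dec 3 (f 3))) (T (dec 3 (f 4))) (T (dec 3 (f 5))) (T (dec 3 (f 6))) (T (dec 3 (f 7))) := by
  rw [← h 0, ← h 1, ← h 2, ← h 3, ← h 4, ← h 5, ← h 6, ← h 7]
  rfl

theorem total8_of_eq {F G : Fun8} {u : Fin 3 → Fin 2} {p : Fin 3 → Fin 3}
    (hp : Function.Injective p)
    (h : ∀ T, of8 G T = of8 F T + of8 F (T ∘ vtx u p)) (s : (Fin n → Fin 2) → Bool) :
    total8 G s = 2 * total8 F s := by
  unfold total8
  simp only [h, Finset.sum_add_distrib]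
  have h1 := sum_frames_symm (of8 F) s u hp
  simp only [← Function.comp_assoc] at h1
  rw [h1, two_mul]

theorem total8_symFlip0 (F : Fun8) (s : (Fin n → Fin 2) → Bool) :
    total8 (symFlip0 F) s = 2 * total8 F s := by
  refine total8_of_eq (u := dec 3 1) (p := id) Function.injective_id (fun T => ?_) s
  rw [of8_comp_vtx (f := ![1, 0, 3, 2, 5, 4, 7, 6]) (by decide)]
  rfl

theorem total8_symFlip1 (F : Fun8) (s : (Fin n → Fin 2) → Bool) :
    total8 (symFlip1 F) s = 2 * total8 F s := by
  refine total8_of_eq (u := dec 3 2) (p := id) Function.injective_id (fun T => ?_) s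
  rw [of8_comp_vtx (f := ![2, 3, 0, 1, 6, 7, 4, 5]) (by decide)]
  rfl

theorem total8_symFlip2 (F : Fun8) (s : (Fin n → Fin 2) → Bool) :
    total8 (symFlip2 F) s = 2 * total8 F s := by
  refine total8_of_eq (u := dec 3 4) (p := id) Function.injective_id (fun T => ?_) s
  rw [of8_comp_vtx (f := ![4, 5, 6, 7, 0, 1, 2, 3]) (by decide)]
  rfl

theorem total8_symSwap (F : Fun8) (s : (Fin n → Fin 2) → Bool) :
    total8 (symSwap F) s = 2 * total8 F s := by
  refine total8_of_eq (u := 0) (p := ![1, 0, 2]) (by decide) (fun T => ?_) s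
  rw [of8_comp_vtx (f := ![0, 2, 1, 3, 4, 6, 5, 7]) (by decide)]
  rfl

theorem total8_symRot (F : Fun8) (s : (Fin n → Fin 2) → Bool) :
    total8 (symRot F) s = 3 * total8 F s := by
  have h : ∀ T, of8 (symRot F) T = of8 F T + (of8 F (T ∘ vtx 0 ![2, 1, 0]) +
      of8 F (T ∘ vtx 0 ![0, 2, 1])) := by
    intro T
    rw [of8_comp_vtx (f := ![0, 4, 2, 6, 1, 5, 3, 7]) (by decide),
      of8_comp_vtx (f := ![0, 1, 4, 5, 2, 3, 6, 7]) (by decide)]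
    rfl
  unfold total8
  simp only [h, Finset.sum_add_distrib]
  have h1 := sum_frames_symm (of8 F) s 0 (p := ![2, 1, 0]) (by decide)
  have h2 := sum_frames_symm (of8 F) s 0 (p := ![0, 2, 1]) (by decide)
  simp only [← Function.comp_assoc] at h1 h2
  rw [h1, h2]
  ring

theorem total8_symm8 (F : Fun8) (s : (Fin n → Fin 2) → Bool) :
    total8 (symm8 F) s = 48 * total8 F s := by
  rw [symm8, total8_symRot, total8_symSwap, total8_symFlip2, total8_symFlip1, total8_symFlip0]
  ring

theorem of_all8 {p : Bool → Bool → Bool → Bool → Bool → Bool → Bool → Bool → Bool}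
    (h : all8 p = true) (b0 b1 b2 b3 b4 b5 b6 b7 : Bool) : p b0 b1 b2 b3 b4 b5 b6 b7 = true := by
  have hl : ∀ {p : Bool → Bool}, [false, true].all p = true → ∀ b, p b = true := by
    intro p hp b
    rw [List.all_eq_true] at hp
    exact hp b (by cases b <;> simp)
  unfold all8 at h
  have h := hl h b0
  have h := hl h b1
  have h := hl h b2
  have h := hl h b3
  have h := hl h b4
  have h := hl h b5
  have h := hl h b6
  exact hl h b7

theorem le_of_certCheck {F : Fun8} {K : ℕ} (h : certCheck F K = true)
    (b0 b1 b2 b3 b4 b5 b6 b7 : Bool) : symm8 F b0 b1 b2 b3 b4 b5 b6 b7 ≤ K :=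
  Nat.le_of_ble_eq_true (of_all8 h ..)

/-- Symmetrizing multiplies the total by 48, so a pointwise bound is needed only for the symmetrized
function. It holds on degenerate frames too, since they also induce patterns on Q_3. -/
theorem total8_le_of_certCheck {F : Fun8} {K : ℕ} (h : certCheck F (48 * K) = true)
    (s : (Fin n → Fin 2) → Bool) : total8 F s ≤ K * (2 ^ n * n ^ 3) := by
  have h1 : total8 (symm8 F) s ≤ ∑ _d : Fin 3 → Fin n, ∑ _x : Fin n → Fin 2, 48 * K :=
    Finset.sum_le_sum fun d _ => Finset.sum_le_sum fun x _ => le_of_certCheck h ..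
  rw [total8_symm8] at h1
  simp only [Finset.sum_const, Finset.card_univ, Fintype.card_pi, Fintype.card_fin,
    Finset.prod_const, smul_eq_mul] at h1
  nlinarith

/-- The shared root edge has direction 2 (codes 0 and 4); the two flags extend it in directions 1
and 0. -/
theorem sum_square_nonneg (Q : Square) (s : (Fin n → Fin 2) → Bool) :
    0 ≤ ∑ d : Fin 3 → Fin n, ∑ x, Q.eval ((s ∘ vtx x d) (dec 3 0)) ((s ∘ vtx x d) (dec 3 4))
        ((s ∘ vtx x d) (dec 3 2)) ((s ∘ vtx x d) (dec 3 6)) *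
      Q.eval ((s ∘ vtx x d) (dec 3 0)) ((s ∘ vtx x d) (dec 3 4))
        ((s ∘ vtx x d) (dec 3 1)) ((s ∘ vtx x d) (dec 3 5)) := by
  have h := sum_frames_mul_nonneg (k := 1) (fun T : (Fin 2 → Fin 2) → Bool =>
    Q.eval (T (dec 2 0)) (T (dec 2 2)) (T (dec 2 1)) (T (dec 2 3))) s
  have e : ∀ c : Fin 4, vtx 0 Fin.succ (dec 2 c) = dec 3 ((![0, 2, 4, 6] : Fin 4 → ℕ) c) := by
    decide
  have e' : ∀ c : Fin 4, vtx 0 (Fin.succAbove (1 : Fin 3)) (dec 2 c) =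
      dec 3 ((![0, 1, 4, 5] : Fin 4 → ℕ) c) := by
    decide
  have a0 := e 0
  have a1 := e 1
  have a2 := e 2
  have a3 := e 3
  have a0' := e' 0
  have a1' := e' 1
  have a2' := e' 2
  have a3' := e' 3
  simp only [Function.comp_apply] at h ⊢
  refine h.trans_eq ?_
  refine Finset.sum_congr rfl fun d _ => Finset.sum_congr rfl fun x _ => ?_
  change vtx 0 Fin.succ (dec 2 0) = dec 3 0 at a0
  change vtx 0 Fin.succ (dec 2 1) = dec 3 2 at a1
  change vtx 0 Fin.succ (dec 2 2) = dec 3 4 at a2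
  change vtx 0 Fin.succ (dec 2 3) = dec 3 6 at a3
  change vtx 0 (Fin.succAbove 1) (dec 2 0) = dec 3 0 at a0'
  change vtx 0 (Fin.succAbove 1) (dec 2 1) = dec 3 1 at a1'
  change vtx 0 (Fin.succAbove 1) (dec 2 2) = dec 3 4 at a2'
  change vtx 0 (Fin.succAbove 1) (dec 2 3) = dec 3 5 at a3'
  rw [a0, a1, a2, a3, a0', a1', a2', a3']

theorem matches8_of_forall {mask : ℕ} {t : ℕ → Bool} (h : ∀ c < 8, t c = mask.testBit c) :
    matches8 mask (t 0) (t 1) (t 2) (t 3) (t 4) (t 5) (t 6) (t 7) = true := by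
  simp [matches8, h]

-- Only an inequality, because the right side also counts degenerate frames; there are only O(2^n
-- n^2) of those.
open Classical in
theorem card_frames_le_sum_matches {H : Set (Fin 3 → Fin 2)} {mask : ℕ}
    (hH : ∀ c < 8, dec 3 c ∈ H ↔ mask.testBit c = true) (S : Set (Fin n → Fin 2)) :
    (frames H S).card ≤ ∑ d : Fin 3 → Fin n, ∑ x,
      of8 (fun b0 b1 b2 b3 b4 b5 b6 b7 => cond (matches8 mask b0 b1 b2 b3 b4 b5 b6 b7) 1 0)
        ((fun y => decide (y ∈ S)) ∘ vtx x d) := by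
  rw [Finset.sum_comm, ← Fintype.sum_prod_type', Finset.card_eq_sum_ones]
  refine (Finset.sum_le_sum fun p hp => ?_).trans
    (Finset.sum_le_sum_of_subset (Finset.subset_univ (frames H S)))
  have hm := matches8_of_forall (mask := mask)
    (t := fun c => ((fun y => decide (y ∈ S)) ∘ vtx p.1 p.2) (dec 3 c)) (fun c hc => by
      rw [Bool.eq_iff_iff, ← hH c hc, Function.comp_apply, decide_eq_true_iff]
      exact (mem_frames.1 hp).2 _)
  unfold of8
  beta_reduce
  rw [hm]
  rfl

/-- The upper bound given by a certificate. -/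
theorem card_frames_le_of_certCheck {H : Set (Fin 3 → Fin 2)} {mask A B C : ℕ}
    {Qs : List Square} (hH : ∀ c < 8, dec 3 c ∈ H ↔ mask.testBit c = true)
    (h : certCheck (certValue mask A C Qs) (48 * (B + C)) = true) (S : Set (Fin n → Fin 2)) :
    A * (frames H S).card ≤ B * (2 ^ n * n ^ 3) := by
  classical
  set s : (Fin n → Fin 2) → Bool := fun y => decide (y ∈ S) with hs
  have h1 := total8_le_of_certCheck h s
  have h2 := card_frames_le_sum_matches hH S
  set M := ∑ d : Fin 3 → Fin n, ∑ x,
      of8 (fun b0 b1 b2 b3 b4 b5 b6 b7 => cond (matches8 mask b0 b1 b2 b3 b4 b5 b6 b7) 1 0)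
        (s ∘ vtx x d) with hM
  have h3 : ∀ Qs : List Square, 0 ≤ ∑ d : Fin 3 → Fin n, ∑ x,
      (Qs.map fun Q => (Q.weight : ℤ) * (Q.eval ((s ∘ vtx x d) (dec 3 0))
        ((s ∘ vtx x d) (dec 3 4)) ((s ∘ vtx x d) (dec 3 2)) ((s ∘ vtx x d) (dec 3 6)) *
      Q.eval ((s ∘ vtx x d) (dec 3 0)) ((s ∘ vtx x d) (dec 3 4))
        ((s ∘ vtx x d) (dec 3 1)) ((s ∘ vtx x d) (dec 3 5)))).sum := by
    intro Qs
    induction Qs with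
    | nil => simp
    | cons Q Qs ih =>
      simp only [List.map_cons, List.sum_cons, Finset.sum_add_distrib, ← Finset.mul_sum]
      exact add_nonneg (mul_nonneg (Int.natCast_nonneg _) (sum_square_nonneg Q s)) ih
  have h4 : (A * M + C * (2 ^ n * n ^ 3) : ℤ) + ∑ d : Fin 3 → Fin n, ∑ x,
      (Qs.map fun Q => (Q.weight : ℤ) * (Q.eval ((s ∘ vtx x d) (dec 3 0))
        ((s ∘ vtx x d) (dec 3 4)) ((s ∘ vtx x d) (dec 3 2)) ((s ∘ vtx x d) (dec 3 6)) *
      Q.eval ((s ∘ vtx x d) (dec 3 0)) ((s ∘ vtx x d) (dec 3 4))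
        ((s ∘ vtx x d) (dec 3 1)) ((s ∘ vtx x d) (dec 3 5)))).sum ≤
      (total8 (certValue mask A C Qs) s : ℤ) := by
    have hC : (C * (2 ^ n * n ^ 3) : ℤ) =
        ∑ _d : Fin 3 → Fin n, ∑ _x : Fin n → Fin 2, (C : ℤ) := by
      simp only [Finset.sum_const, Finset.card_univ, Fintype.card_pi, Fintype.card_fin,
        Finset.prod_const, nsmul_eq_mul]
      push_cast
      ring
    rw [hC, hM, total8]
    push_cast
    simp only [Finset.mul_sum, ← Finset.sum_add_distrib]
    refine Finset.sum_le_sum fun d _ => Finset.sum_le_sum fun x _ => ?_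
    -- Truncation at 0 can only increase the value, so the bound is valid whatever the shift `C`.
    refine le_trans (le_of_eq ?_) (Int.self_le_toNat _)
    unfold of8
    congr 2
    dsimp only
    generalize matches8 mask _ _ _ _ _ _ _ _ = b
    cases b <;> simp
  have h5 := h3 Qs
  have h6 : (total8 (certValue mask A C Qs) s : ℤ) ≤ (B + C) * (2 ^ n * n ^ 3) := by
    exact_mod_cast h1
  have h7 : (A * M : ℤ) ≤ B * (2 ^ n * n ^ 3) := by linarith
  calc A * (frames H S).card ≤ A * M := Nat.mul_le_mul_left _ h2
    _ ≤ B * (2 ^ n * n ^ 3) := by exact_mod_cast h7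

end ThreeCube

/-! ### The certificate on four-dimensional cubes -/

section FourCube

/-- Functions of the sixteen values of a pattern on `Q_4`, listed by binary code. -/
abbrev Fun16 := Bool → Bool → Bool → Bool → Bool → Bool → Bool → Bool →
  Bool → Bool → Bool → Bool → Bool → Bool → Bool → Bool → ℕ

def sumFlip0 (F : Fun16) : Fun16 := fun b0 b1 b2 b3 b4 b5 b6 b7 b8 b9 b10 b11 b12 b13 b14 b15 =>
  Nat.add (F b0 b1 b2 b3 b4 b5 b6 b7 b8 b9 b10 b11 b12 b13 b14 b15) (F b1 b0 b3 b2 b5 b4 b7 b6 b9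
    b8 b11 b10 b13 b12 b15 b14)

def sumFlip1 (F : Fun16) : Fun16 := fun b0 b1 b2 b3 b4 b5 b6 b7 b8 b9 b10 b11 b12 b13 b14 b15 =>
  Nat.add (F b0 b1 b2 b3 b4 b5 b6 b7 b8 b9 b10 b11 b12 b13 b14 b15) (F b2 b3 b0 b1 b6 b7 b4 b5 b10
    b11 b8 b9 b14 b15 b12 b13)

def sumFlip2 (F : Fun16) : Fun16 := fun b0 b1 b2 b3 b4 b5 b6 b7 b8 b9 b10 b11 b12 b13 b14 b15 =>
  Nat.add (F b0 b1 b2 b3 b4 b5 b6 b7 b8 b9 b10 b11 b12 b13 b14 b15) (F b4 b5 b6 b7 b0 b1 b2 b3 b12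
    b13 b14 b15 b8 b9 b10 b11)

def sumFlip3 (F : Fun16) : Fun16 := fun b0 b1 b2 b3 b4 b5 b6 b7 b8 b9 b10 b11 b12 b13 b14 b15 =>
  Nat.add (F b0 b1 b2 b3 b4 b5 b6 b7 b8 b9 b10 b11 b12 b13 b14 b15) (F b8 b9 b10 b11 b12 b13 b14
    b15 b0 b1 b2 b3 b4 b5 b6 b7)

def sumSwap23 (F : Fun16) : Fun16 := fun b0 b1 b2 b3 b4 b5 b6 b7 b8 b9 b10 b11 b12 b13 b14 b15 =>
  Nat.add (F b0 b1 b2 b3 b4 b5 b6 b7 b8 b9 b10 b11 b12 b13 b14 b15) (F b0 b1 b2 b3 b8 b9 b10 b11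
    b4 b5 b6 b7 b12 b13 b14 b15)

def sumSwap1 (F : Fun16) : Fun16 := fun b0 b1 b2 b3 b4 b5 b6 b7 b8 b9 b10 b11 b12 b13 b14 b15 =>
  Nat.add (F b0 b1 b2 b3 b4 b5 b6 b7 b8 b9 b10 b11 b12 b13 b14 b15) (Nat.add (F b0 b1 b4 b5 b2 b3
    b6 b7 b8 b9 b12 b13 b10 b11 b14 b15) (F b0 b1 b8 b9 b4 b5 b12 b13 b2 b3 b10 b11 b6 b7 b14
    b15))

def sumSwap0 (F : Fun16) : Fun16 := fun b0 b1 b2 b3 b4 b5 b6 b7 b8 b9 b10 b11 b12 b13 b14 b15 =>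
  Nat.add (F b0 b1 b2 b3 b4 b5 b6 b7 b8 b9 b10 b11 b12 b13 b14 b15) (Nat.add (F b0 b2 b1 b3 b4 b6
    b5 b7 b8 b10 b9 b11 b12 b14 b13 b15) (Nat.add (F b0 b4 b2 b6 b1 b5 b3 b7 b8 b12 b10 b14 b9 b13
    b11 b15) (F b0 b8 b2 b10 b4 b12 b6 b14 b1 b9 b3 b11 b5 b13 b7 b15)))

/-- The sum of a function over all symmetries of `Q_4`. -/
def symm16 (F : Fun16) : Fun16 :=
  sumFlip3 (sumFlip2 (sumFlip1 (sumFlip0 (sumSwap0 (sumSwap1 (sumSwap23 F))))))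

/-- For a square `t₀, t₁, t₂, t₃` (in cyclic order `t₀, t₁, t₃, t₂`) with exactly two opposite
vertices in `S`, the difference of the values on the neighbours of the other two vertices. -/
def diagDiff (t₀ t₁ t₂ t₃ f₀ f₁ f₂ f₃ : Bool) : ℤ :=
  cond (!t₀ && t₁ && t₂ && !t₃) ((f₀.toNat : ℤ) - f₃.toNat)
    (cond (t₀ && !t₁ && !t₂ && t₃) ((f₁.toNat : ℤ) - f₂.toNat) 0)

def matchTerm (b0 b1 b2 b3 b4 b5 b6 b7 : Bool) : ℕ :=
  cond (matches8 22 b0 b1 b2 b3 b4 b5 b6 b7) 1 0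

def diagTerm (t₀ t₁ t₂ t₃ f₀ f₁ f₂ f₃ g₀ g₁ g₂ g₃ : Bool) : ℕ :=
  (diagDiff t₀ t₁ t₂ t₃ f₀ f₁ f₂ f₃ * diagDiff t₀ t₁ t₂ t₃ g₀ g₁ g₂ g₃ + 1).toNat

/-- The certificate for the star with three leaves and no centre. -/
def certStar : Fun16 := fun b0 b1 b2 _ b4 b5 b6 _ b8 b9 b10 _ b12 b13 b14 _ =>
  Nat.add (Nat.mul 12 (matchTerm b0 b2 b4 b6 b8 b10 b12 b14))
    (diagTerm b0 b4 b8 b12 b1 b5 b9 b13 b2 b6 b10 b14)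

/-- The even codes carry the star (mask 22), which leaves 2^8 patterns to examine. The bound 768 = 2
· 384 is an average of 2 over the symmetries of Q_4. -/
theorem certStar_check : (all8 fun b1 b3 b5 b7 b9 b11 b13 b15 =>
    Nat.ble (symm16 certStar false b1 true b3 true b5 false b7 true b9 false b11 false b13 false b15)
      768) = true := by
  decide +kernel

/-- A function of sixteen values, applied to a pattern on `Q_4`. -/
def of16 (F : Fun16) (T : (Fin 4 → Fin 2) → Bool) : ℕ :=
  F (T (dec 4 0)) (T (dec 4 1)) (T (dec 4 2)) (T (dec 4 3)) (T (dec 4 4)) (T (dec 4 5))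
    (T (dec 4 6)) (T (dec 4 7)) (T (dec 4 8)) (T (dec 4 9)) (T (dec 4 10)) (T (dec 4 11))
    (T (dec 4 12)) (T (dec 4 13)) (T (dec 4 14)) (T (dec 4 15))

theorem of16_comp_vtx {u : Fin 4 → Fin 2} {p : Fin 4 → Fin 4} {f : Fin 16 → ℕ}
    (h : ∀ c : Fin 16, vtx u p (dec 4 c) = dec 4 (f c)) (F : Fun16)
    (T : (Fin 4 → Fin 2) → Bool) :
    of16 F (T ∘ vtx u p) =
      F (T (dec 4 (f 0))) (T (dec 4 (f 1))) (T (dec 4 (f 2))) (T (dec 4 (f 3)))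
        (T (dec 4 (f 4))) (T (dec 4 (f 5))) (T (dec 4 (f 6))) (T (dec 4 (f 7)))
        (T (dec 4 (f 8))) (T (dec 4 (f 9))) (T (dec 4 (f 10))) (T (dec 4 (f 11)))
        (T (dec 4 (f 12))) (T (dec 4 (f 13))) (T (dec 4 (f 14))) (T (dec 4 (f 15))) := by
  rw [← h 0, ← h 1, ← h 2, ← h 3, ← h 4, ← h 5, ← h 6, ← h 7, ← h 8, ← h 9, ← h 10, ← h 11,
    ← h 12, ← h 13, ← h 14, ← h 15]
  rfl

theorem of16_sumFlip0 (F : Fun16) (T : (Fin 4 → Fin 2) → Bool) :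
    of16 (sumFlip0 F) T = ∑ t, of16 F (T ∘ vtx ((![0, dec 4 1] : Fin 2 → Fin 4 → Fin 2) t) id) := by
  rw [Fin.sum_univ_two, of16_comp_vtx (f := ![0, 1, 2, 3, 4, 5, 6, 7, 8, 9, 10, 11, 12, 13, 14, 15]) (by decide),
    of16_comp_vtx (f := ![1, 0, 3, 2, 5, 4, 7, 6, 9, 8, 11, 10, 13, 12, 15, 14]) (by decide)]
  rfl

theorem of16_sumFlip1 (F : Fun16) (T : (Fin 4 → Fin 2) → Bool) :
    of16 (sumFlip1 F) T = ∑ t, of16 F (T ∘ vtx ((![0, dec 4 2] : Fin 2 → Fin 4 → Fin 2) t) id) := by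
  rw [Fin.sum_univ_two, of16_comp_vtx (f := ![0, 1, 2, 3, 4, 5, 6, 7, 8, 9, 10, 11, 12, 13, 14, 15]) (by decide),
    of16_comp_vtx (f := ![2, 3, 0, 1, 6, 7, 4, 5, 10, 11, 8, 9, 14, 15, 12, 13]) (by decide)]
  rfl

theorem of16_sumFlip2 (F : Fun16) (T : (Fin 4 → Fin 2) → Bool) :
    of16 (sumFlip2 F) T = ∑ t, of16 F (T ∘ vtx ((![0, dec 4 4] : Fin 2 → Fin 4 → Fin 2) t) id) := by
  rw [Fin.sum_univ_two, of16_comp_vtx (f := ![0, 1, 2, 3, 4, 5, 6, 7, 8, 9, 10, 11, 12, 13, 14, 15]) (by decide),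
    of16_comp_vtx (f := ![4, 5, 6, 7, 0, 1, 2, 3, 12, 13, 14, 15, 8, 9, 10, 11]) (by decide)]
  rfl

theorem of16_sumFlip3 (F : Fun16) (T : (Fin 4 → Fin 2) → Bool) :
    of16 (sumFlip3 F) T = ∑ t, of16 F (T ∘ vtx ((![0, dec 4 8] : Fin 2 → Fin 4 → Fin 2) t) id) := by
  rw [Fin.sum_univ_two, of16_comp_vtx (f := ![0, 1, 2, 3, 4, 5, 6, 7, 8, 9, 10, 11, 12, 13, 14, 15]) (by decide),
    of16_comp_vtx (f := ![8, 9, 10, 11, 12, 13, 14, 15, 0, 1, 2, 3, 4, 5, 6, 7]) (by decide)]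
  rfl

theorem of16_sumSwap23 (F : Fun16) (T : (Fin 4 → Fin 2) → Bool) :
    of16 (sumSwap23 F) T = ∑ t, of16 F (T ∘ vtx 0 ((![id, ![0, 1, 3, 2]] : Fin 2 → Fin 4 → Fin 4) t)) := by
  rw [Fin.sum_univ_two, of16_comp_vtx (f := ![0, 1, 2, 3, 4, 5, 6, 7, 8, 9, 10, 11, 12, 13, 14, 15]) (by decide),
    of16_comp_vtx (f := ![0, 1, 2, 3, 8, 9, 10, 11, 4, 5, 6, 7, 12, 13, 14, 15]) (by decide)]
  rfl

theorem of16_sumSwap1 (F : Fun16) (T : (Fin 4 → Fin 2) → Bool) :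
    of16 (sumSwap1 F) T = ∑ t, of16 F (T ∘ vtx 0 ((![id, ![0, 2, 1, 3], ![0, 3, 2, 1]] : Fin 3 → Fin 4 → Fin 4) t)) := by
  rw [Fin.sum_univ_three, of16_comp_vtx (f := ![0, 1, 2, 3, 4, 5, 6, 7, 8, 9, 10, 11, 12, 13, 14, 15]) (by decide),
    of16_comp_vtx (f := ![0, 1, 4, 5, 2, 3, 6, 7, 8, 9, 12, 13, 10, 11, 14, 15]) (by decide),
    of16_comp_vtx (f := ![0, 1, 8, 9, 4, 5, 12, 13, 2, 3, 10, 11, 6, 7, 14, 15]) (by decide)]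
  simp only [add_assoc]
  rfl

theorem of16_sumSwap0 (F : Fun16) (T : (Fin 4 → Fin 2) → Bool) :
    of16 (sumSwap0 F) T = ∑ t, of16 F (T ∘ vtx 0 ((![id, ![1, 0, 2, 3], ![2, 1, 0, 3], ![3, 1, 2, 0]] : Fin 4 → Fin 4 → Fin 4) t)) := by
  rw [Fin.sum_univ_four, of16_comp_vtx (f := ![0, 1, 2, 3, 4, 5, 6, 7, 8, 9, 10, 11, 12, 13, 14, 15]) (by decide),
    of16_comp_vtx (f := ![0, 2, 1, 3, 4, 6, 5, 7, 8, 10, 9, 11, 12, 14, 13, 15]) (by decide),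
    of16_comp_vtx (f := ![0, 4, 2, 6, 1, 5, 3, 7, 8, 12, 10, 14, 9, 13, 11, 15]) (by decide),
    of16_comp_vtx (f := ![0, 8, 2, 10, 4, 12, 6, 14, 1, 9, 3, 11, 5, 13, 7, 15]) (by decide)]
  simp only [add_assoc]
  rfl

theorem comp_vtx_comp_vtx {N : ℕ} (T : (Fin N → Fin 2) → Bool) (u v : Fin N → Fin 2)
    (p q : Fin N → Fin N) : (T ∘ vtx u p) ∘ vtx v q = T ∘ vtx (vtx u p v) (p ∘ q) := by
  funext w
  simp [vtx_vtx]

/-- The permutations of the four coordinates. -/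
def perms4 : Finset (Fin 4 → Fin 4) := univ.filter fun p => Function.Injective p

/-- A permutation as a product of transpositions. -/
def perm4 (t : Fin 4 × Fin 3 × Fin 2) : Fin 4 → Fin 4 :=
  (![id, ![1, 0, 2, 3], ![2, 1, 0, 3], ![3, 1, 2, 0]] : Fin 4 → Fin 4 → Fin 4) t.1 ∘
    (![id, ![0, 2, 1, 3], ![0, 3, 2, 1]] : Fin 3 → Fin 4 → Fin 4) t.2.1 ∘
    (![id, ![0, 1, 3, 2]] : Fin 2 → Fin 4 → Fin 4) t.2.2

theorem perm4_injective : Function.Injective perm4 := by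
  decide +kernel

theorem image_perm4 : univ.image perm4 = perms4 := by
  decide +kernel

theorem sum_perms4 (G : (Fin 4 → Fin 4) → ℕ) : ∑ p ∈ perms4, G p = ∑ t, G (perm4 t) := by
  rw [← image_perm4, Finset.sum_image fun _ _ _ _ h => perm4_injective h]

/-- A vertex as a sum of unit vectors. -/
def flips4 (t : Fin 2 × Fin 2 × Fin 2 × Fin 2) : Fin 4 → Fin 2 :=
  vtx (vtx (vtx ((![0, dec 4 8] : Fin 2 → Fin 4 → Fin 2) t.1) id ((![0, dec 4 4] : Fin 2 → Fin 4 → Fin 2) t.2.1)) id ((![0, dec 4 2] : Fin 2 → Fin 4 → Fin 2) t.2.2.1)) id ((![0, dec 4 1] : Fin 2 → Fin 4 → Fin 2) t.2.2.2)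

theorem flips4_bijective : Function.Bijective flips4 := by
  decide +kernel

/-- Each symmetry of Q_4 is uniquely a product of the chosen flips and transpositions, so the nested
sums run over the whole group. This makes invariance of the symmetrized function available. -/
theorem of16_symm16 (F : Fun16) (T : (Fin 4 → Fin 2) → Bool) :
    of16 (symm16 F) T = ∑ u, ∑ p ∈ perms4, of16 F (T ∘ vtx u p) := by
  rw [← flips4_bijective.sum_comp]
  simp only [sum_perms4, Fintype.sum_prod_type, symm16, of16_sumFlip3, of16_sumFlip2,
    of16_sumFlip1, of16_sumFlip0, of16_sumSwap0, of16_sumSwap1, of16_sumSwap23,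
    comp_vtx_comp_vtx, vtx_zero, Function.id_comp, Function.comp_id, flips4, perm4]
  simp only [Function.comp_assoc]

theorem of16_symm16_comp (F : Fun16) (T : (Fin 4 → Fin 2) → Bool) (u₀ : Fin 4 → Fin 2)
    {p₀ : Fin 4 → Fin 4} (hp₀ : Function.Injective p₀) :
    of16 (symm16 F) (T ∘ vtx u₀ p₀) = of16 (symm16 F) T := by
  simp only [of16_symm16, comp_vtx_comp_vtx]
  have hu : Function.Bijective (vtx u₀ p₀) :=
    Finite.injective_iff_bijective.1 (vtx_injective u₀ hp₀)
  rw [hu.sum_comp (fun u => ∑ p ∈ perms4, of16 F (T ∘ vtx u (p₀ ∘ p)))]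
  refine Finset.sum_congr rfl fun u _ => ?_
  refine Finset.sum_equiv (Equiv.arrowCongr (Equiv.refl _)
    (Equiv.ofBijective p₀ (Finite.injective_iff_bijective.1 hp₀))) (fun p => ?_) fun p _ => rfl
  simp only [perms4, Finset.mem_filter, Finset.mem_univ, true_and]
  exact ⟨fun h => hp₀.comp h, fun h => Function.Injective.of_comp h⟩

theorem diagTerm_le (t₀ t₁ t₂ t₃ f₀ f₁ f₂ f₃ g₀ g₁ g₂ g₃ : Bool) :
    diagTerm t₀ t₁ t₂ t₃ f₀ f₁ f₂ f₃ g₀ g₁ g₂ g₃ ≤ 2 := by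
  have h : ∀ t₀ t₁ t₂ t₃ f₀ f₁ f₂ f₃, |diagDiff t₀ t₁ t₂ t₃ f₀ f₁ f₂ f₃| ≤ 1 := by decide
  unfold diagTerm
  have h1 := abs_le.1 (h t₀ t₁ t₂ t₃ f₀ f₁ f₂ f₃)
  have h2 := abs_le.1 (h t₀ t₁ t₂ t₃ g₀ g₁ g₂ g₃)
  have : diagDiff t₀ t₁ t₂ t₃ f₀ f₁ f₂ f₃ * diagDiff t₀ t₁ t₂ t₃ g₀ g₁ g₂ g₃ ≤ 1 := by
    nlinarith
  omega

/-- Whether the pattern restricted to the last three coordinates is the star without centre. -/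
def hasStar (T : (Fin 4 → Fin 2) → Bool) : Bool :=
  matches8 22 (T (dec 4 0)) (T (dec 4 2)) (T (dec 4 4)) (T (dec 4 6)) (T (dec 4 8))
    (T (dec 4 10)) (T (dec 4 12)) (T (dec 4 14))

/-- If some 3-face shows the star, invariance moves it to the face of even codes, where the finite
check applies. Otherwise every match term vanishes and each summand is at most 2. -/
theorem of16_symm16_certStar_le (T : (Fin 4 → Fin 2) → Bool) :
    of16 (symm16 certStar) T ≤ 768 := by
  by_cases hT : ∃ u, ∃ p ∈ perms4, hasStar (T ∘ vtx u p) = true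
  · obtain ⟨u, p, hp, h⟩ := hT
    rw [perms4, Finset.mem_filter] at hp
    rw [← of16_symm16_comp certStar T u hp.2]
    generalize T ∘ vtx u p = T' at h
    simp only [hasStar, matches8, Bool.and_eq_true, beq_iff_eq] at h
    obtain ⟨⟨⟨⟨⟨⟨⟨h0, h1⟩, h2⟩, h3⟩, h4⟩, h5⟩, h6⟩, h7⟩ := h
    unfold of16
    rw [h0, h1, h2, h3, h4, h5, h6, h7]
    exact Nat.le_of_ble_eq_true (of_all8 certStar_check ..)
  · push Not at hT
    rw [of16_symm16]
    have hle : ∀ u, ∀ p ∈ perms4, of16 certStar (T ∘ vtx u p) ≤ 2 := by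
      intro u p hp
      have h := hT u p hp
      rw [hasStar, ne_eq, Bool.not_eq_true] at h
      unfold of16 certStar matchTerm
      rw [h]
      exact (Nat.zero_add _).trans_le (diagTerm_le ..)
    refine (Finset.sum_le_sum fun u _ => Finset.sum_le_sum (hle u)).trans ?_
    decide +kernel

variable {n : ℕ}

theorem sum_frames_comm {N : ℕ} {β : Type*} (U : Finset β)
    (K : (Fin N → Fin n) → (Fin n → Fin 2) → β → ℕ) :
    ∑ d, ∑ x, ∑ u ∈ U, K d x u = ∑ u ∈ U, ∑ d, ∑ x, K d x u :=
  (Finset.sum_congr rfl fun _ _ => Finset.sum_comm).trans Finset.sum_comm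

theorem sum_frames_certStar_le (s : (Fin n → Fin 2) → Bool) :
    ∑ d : Fin 4 → Fin n, ∑ x, of16 certStar (s ∘ vtx x d) ≤ 2 * (2 ^ n * n ^ 4) := by
  have h1 : ∑ d : Fin 4 → Fin n, ∑ x, of16 (symm16 certStar) (s ∘ vtx x d) ≤
      ∑ _d : Fin 4 → Fin n, ∑ _x : Fin n → Fin 2, 768 :=
    Finset.sum_le_sum fun d _ => Finset.sum_le_sum fun x _ => of16_symm16_certStar_le _
  have h2 : ∀ u : Fin 4 → Fin 2, ∀ p ∈ perms4, ∑ d : Fin 4 → Fin n, ∑ x,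
      of16 certStar ((s ∘ vtx x d) ∘ vtx u p) =
      ∑ d : Fin 4 → Fin n, ∑ x, of16 certStar (s ∘ vtx x d) := fun u p hp =>
    sum_frames_symm (of16 certStar) s u (Finset.mem_filter.1 hp).2
  simp only [of16_symm16] at h1
  rw [sum_frames_comm] at h1
  simp only [sum_frames_comm] at h1
  rw [Finset.sum_congr rfl fun u _ => Finset.sum_congr rfl (h2 u)] at h1
  have hc : perms4.card = 24 := by decide +kernel
  simp only [Finset.sum_const, Finset.card_univ, Fintype.card_pi, Fintype.card_fin,
    Finset.prod_const, smul_eq_mul, hc] at h1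
  nlinarith

/-- The root is the 2-face in directions 2 and 3. The squared quantity compares how many neighbours
in `S` the two opposite vertices outside the diagonal pair have. -/
theorem sum_diagDiff_nonneg (s : (Fin n → Fin 2) → Bool) :
    0 ≤ ∑ d : Fin 4 → Fin n, ∑ x,
      diagDiff ((s ∘ vtx x d) (dec 4 0)) ((s ∘ vtx x d) (dec 4 4)) ((s ∘ vtx x d) (dec 4 8))
        ((s ∘ vtx x d) (dec 4 12)) ((s ∘ vtx x d) (dec 4 1)) ((s ∘ vtx x d) (dec 4 5))
        ((s ∘ vtx x d) (dec 4 9)) ((s ∘ vtx x d) (dec 4 13)) *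
      diagDiff ((s ∘ vtx x d) (dec 4 0)) ((s ∘ vtx x d) (dec 4 4)) ((s ∘ vtx x d) (dec 4 8))
        ((s ∘ vtx x d) (dec 4 12)) ((s ∘ vtx x d) (dec 4 2)) ((s ∘ vtx x d) (dec 4 6))
        ((s ∘ vtx x d) (dec 4 10)) ((s ∘ vtx x d) (dec 4 14)) := by
  have h := sum_frames_mul_nonneg (k := 2) (fun T : (Fin 3 → Fin 2) → Bool =>
    diagDiff (T (dec 3 0)) (T (dec 3 2)) (T (dec 3 4)) (T (dec 3 6)) (T (dec 3 1)) (T (dec 3 3))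
      (T (dec 3 5)) (T (dec 3 7))) s
  have e : ∀ c < 8, vtx 0 Fin.succ (dec 3 c) = dec 4 (2 * c) := by decide
  have e' : ∀ c < 8, vtx 0 (Fin.succAbove (1 : Fin 4)) (dec 3 c) =
      dec 4 (c + 2 * (c / 2)) := by decide
  refine h.trans_eq (Finset.sum_congr rfl fun d _ => Finset.sum_congr rfl fun x _ => ?_)
  rw [mul_comm]
  simp only [Function.comp_apply]
  rw [e 0 (by norm_num), e 1 (by norm_num), e 2 (by norm_num), e 3 (by norm_num),
    e 4 (by norm_num), e 5 (by norm_num), e 6 (by norm_num), e 7 (by norm_num),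
    e' 0 (by norm_num), e' 1 (by norm_num), e' 2 (by norm_num), e' 3 (by norm_num),
    e' 4 (by norm_num), e' 5 (by norm_num), e' 6 (by norm_num), e' 7 (by norm_num)]

/-- The upper bound for the star with three leaves and no centre. -/
theorem card_frames_star_le {H : Set (Fin 3 → Fin 2)}
    (hH : ∀ c < 8, dec 3 c ∈ H ↔ Nat.testBit 22 c = true) (S : Set (Fin n → Fin 2)) :
    12 * (frames H S).card ≤ 2 ^ n * n ^ 3 := by
  classical
  set s : (Fin n → Fin 2) → Bool := fun y => decide (y ∈ S) with hs
  have h1 := sum_frames_certStar_le s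
  have h2 := card_frames_le_sum_matches hH S
  set M := ∑ d : Fin 3 → Fin n, ∑ x,
      of8 (fun b0 b1 b2 b3 b4 b5 b6 b7 => cond (matches8 22 b0 b1 b2 b3 b4 b5 b6 b7) 1 0)
        (s ∘ vtx x d) with hM
  have h3 := sum_diagDiff_nonneg s
  -- The star is read off directions 1, 2, 3 only, so direction 0 is free and contributes a factor
  -- n.
  have hn : ∑ d : Fin 4 → Fin n, ∑ x, (cond (hasStar (s ∘ vtx x d)) 1 0 : ℕ) = n * M := by
    have e : ∀ c < 8, vtx 0 Fin.succ (dec 3 c) = dec 4 (2 * c) := by decide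
    have hd : ∀ (d : Fin 4 → Fin n) x, ∀ c < 8,
        (s ∘ vtx x (d ∘ Fin.succ)) (dec 3 c) = (s ∘ vtx x d) (dec 4 (2 * c)) := by
      intro d x c hc
      simp only [Function.comp_apply]
      rw [← e c hc, vtx_vtx, vtx_zero]
    rw [← (Fin.consEquiv fun _ => Fin n).sum_comp, Fintype.sum_prod_type, hM]
    rw [Finset.sum_congr rfl (g := fun _ => M), Finset.sum_const, Finset.card_univ,
      Fintype.card_fin, smul_eq_mul]
    intro e _
    refine Finset.sum_congr rfl fun d _ => Finset.sum_congr rfl fun x _ => ?_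
    have hc : (Fin.consEquiv fun _ => Fin n) (e, d) ∘ Fin.succ = d := by
      funext i
      simp [Fin.consEquiv]
    have hd := hd ((Fin.consEquiv fun _ => Fin n) (e, d)) x
    rw [hc] at hd
    unfold hasStar of8
    rw [hd 0 (by norm_num), hd 1 (by norm_num), hd 2 (by norm_num), hd 3 (by norm_num),
      hd 4 (by norm_num), hd 5 (by norm_num), hd 6 (by norm_num), hd 7 (by norm_num)]
  have h4 : (12 * (n * M) + 2 ^ n * n ^ 4 : ℤ) ≤
      ((∑ d : Fin 4 → Fin n, ∑ x, of16 certStar (s ∘ vtx x d) : ℕ) : ℤ) := by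
    have hC : (2 ^ n * n ^ 4 : ℤ) = ∑ _d : Fin 4 → Fin n, ∑ _x : Fin n → Fin 2, (1 : ℤ) := by
      simp only [Finset.sum_const, Finset.card_univ, Fintype.card_pi, Fintype.card_fin,
        Finset.prod_const, nsmul_eq_mul]
      push_cast
      ring
    have hn' : ((n * M : ℕ) : ℤ) =
        ∑ d : Fin 4 → Fin n, ∑ x, ((cond (hasStar (s ∘ vtx x d)) 1 0 : ℕ) : ℤ) := by
      rw [← hn]
      push_cast
      rfl
    push_cast at hn'
    rw [hn', hC]
    refine (le_add_of_nonneg_right h3).trans ?_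
    push_cast
    simp only [Finset.mul_sum, ← Finset.sum_add_distrib]
    refine Finset.sum_le_sum fun d _ => Finset.sum_le_sum fun x _ => ?_
    have key : ∀ (m : Bool) (t₀ t₁ t₂ t₃ f₀ f₁ f₂ f₃ g₀ g₁ g₂ g₃ : Bool),
        (12 * ((cond m 1 0 : ℕ) : ℤ) + 1 + diagDiff t₀ t₁ t₂ t₃ f₀ f₁ f₂ f₃ *
          diagDiff t₀ t₁ t₂ t₃ g₀ g₁ g₂ g₃) ≤
        ((12 * (cond m 1 0) + diagTerm t₀ t₁ t₂ t₃ f₀ f₁ f₂ f₃ g₀ g₁ g₂ g₃ : ℕ) : ℤ) := by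
      intros
      unfold diagTerm
      push_cast
      omega
    exact key ..
  have h5 : 12 * (n * M) ≤ 2 ^ n * n ^ 4 := by
    have : ((∑ d : Fin 4 → Fin n, ∑ x, of16 certStar (s ∘ vtx x d) : ℕ) : ℤ) ≤
      2 * (2 ^ n * n ^ 4) := by exact_mod_cast h1
    have : (12 * (n * M) : ℤ) ≤ 2 ^ n * n ^ 4 := by linarith
    exact_mod_cast this
  -- Cancelling the factor n needs n > 0; for n = 0 there are no frames.
  rcases Nat.eq_zero_or_pos n with rfl | hpos
  · have : (frames H S).card = 0 := by
      rw [Finset.card_eq_zero]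
      exact Finset.eq_empty_of_forall_notMem fun p _ => (p.2 0).elim0
    simp [this]
  · refine (Nat.mul_le_mul_left 12 h2).trans (Nat.le_of_mul_le_mul_left ?_ hpos)
    calc n * (12 * M) = 12 * (n * M) := by ring
      _ ≤ 2 ^ n * n ^ 4 := h5
      _ = n * (2 ^ n * n ^ 3) := by ring

end FourCube

/-! ### Lower bounds from colourings by finite abelian groups -/

section Lower

variable {n N : ℕ}

/-- A uniform `y` restricts to a uniform `y ∘ d`. The group structure on `K` serves only to
translate. -/
theorem sum_comp_injective {K : Type*} [AddCommGroup K] [Fintype K] {d : Fin N → Fin n}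
    (hd : Function.Injective d) (k : (Fin N → K) → ℕ) :
    Fintype.card K ^ N * ∑ y : Fin n → K, k (y ∘ d) = Fintype.card K ^ n * ∑ t, k t := by
  have h : ∀ t : Fin N → K, ∑ y : Fin n → K, k (y ∘ d + t) = ∑ y : Fin n → K, k (y ∘ d) := by
    intro t
    refine Fintype.sum_equiv (Equiv.addRight (Function.extend d t 0)) _ _ fun y => ?_
    congr 1
    funext a
    simp [hd.extend_apply]
  have h1 : ∑ t : Fin N → K, ∑ y : Fin n → K, k (y ∘ d + t) =
      Fintype.card K ^ N * ∑ y : Fin n → K, k (y ∘ d) := by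
    simp only [h, Finset.sum_const, Finset.card_univ, Fintype.card_pi, Fintype.card_fin,
      Finset.prod_const, smul_eq_mul]
  rw [← h1, Finset.sum_comm]
  have h2 : ∀ y : Fin n → K, ∑ t, k (y ∘ d + t) = ∑ t, k t := fun y =>
    Fintype.sum_equiv (Equiv.addLeft (y ∘ d)) _ _ fun t => rfl
  simp only [h2, Finset.sum_const, Finset.card_univ, Fintype.card_pi, Fintype.card_fin,
    Finset.prod_const, smul_eq_mul]

variable {G ι : Type*} [AddCommGroup G] [AddCommGroup ι]

/-- The total weight of a vertex, where the coordinate `i`, possibly reflected, carries the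
weight `γ` of its colour. -/
def level (γ : ι → G) (y : Fin N → Fin 2 × ι) (x : Fin N → Fin 2) : G :=
  ∑ i, (x i + (y i).1).val • γ (y i).2

/-- The vertices whose weight, shifted by `h`, lies in `A`. -/
def levelSet (γ : ι → G) (A : G → Bool) (h : G) (y : Fin n → Fin 2 × ι) : Set (Fin n → Fin 2) :=
  {x | A (h + level γ y x) = true}

theorem level_vtx (γ : ι → G) (y : Fin n → Fin 2 × ι) (x : Fin n → Fin 2) {d : Fin N → Fin n}
    (hd : Function.Injective d) (v : Fin N → Fin 2) :
    level γ y (vtx x d v) =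
      ∑ i ∈ (univ.image d)ᶜ, (x i + (y i).1).val • γ (y i).2 +
        level γ ((fun i => (x i, (0 : ι)) + y i) ∘ d) v := by
  unfold level
  rw [← Finset.sum_compl_add_sum (univ.image d), Finset.sum_image fun a _ b _ h => hd h]
  congr 1
  · refine Finset.sum_congr rfl fun i hi => ?_
    rw [vtx_apply_of_notMem]
    intro a ha
    simp only [Finset.mem_compl, Finset.mem_image, Finset.mem_univ, true_and] at hi
    exact hi ⟨a, ha⟩
  · refine Finset.sum_congr rfl fun a _ => ?_
    rw [vtx_apply x hd]
    simp [add_comm, add_left_comm]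

variable [Fintype G] [Fintype ι]

open Classical in
/-- The local patterns that equal `H`. -/
noncomputable def goodLocal (H : Set (Fin 3 → Fin 2)) (γ : ι → G) (A : G → Bool)
    (t : Fin 3 → Fin 2 × ι) : ℕ :=
  (univ.filter fun h : G => ∀ v, A (h + level γ t v) = true ↔ v ∈ H).card

-- The coordinates outside the frame add a constant to the level, which the uniform shift `h`
-- absorbs. Only the colours along `d` matter, and they are uniform.
open Classical in
theorem sum_levelSet_eq (H : Set (Fin 3 → Fin 2)) (γ : ι → G) (A : G → Bool)
    (x : Fin n → Fin 2) {d : Fin 3 → Fin n} (hd : Function.Injective d) :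
    Fintype.card (Fin 2 × ι) ^ 3 * ∑ y : Fin n → Fin 2 × ι,
      (univ.filter fun h : G => ∀ v, vtx x d v ∈ levelSet γ A h y ↔ v ∈ H).card =
    Fintype.card (Fin 2 × ι) ^ n * ∑ t, goodLocal H γ A t := by
  rw [← sum_comp_injective hd]
  congr 1
  refine Fintype.sum_equiv (Equiv.addLeft fun i => (x i, (0 : ι))) _ _ fun y => ?_
  unfold goodLocal
  refine Finset.card_bij (fun h _ => h + ∑ i ∈ (univ.image d)ᶜ, (x i + (y i).1).val • γ (y i).2)
    ?_ ?_ ?_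
  · intro h hh
    simp only [Finset.mem_filter, Finset.mem_univ, true_and] at hh ⊢
    intro v
    rw [← hh v, levelSet, Set.mem_ofPred_eq, level_vtx γ y x hd, add_assoc]
    rfl
  · intro h _ h' _ e
    exact add_right_cancel e
  · intro h hh
    refine ⟨h - ∑ i ∈ (univ.image d)ᶜ, (x i + (y i).1).val • γ (y i).2, ?_, by simp⟩
    simp only [Finset.mem_filter, Finset.mem_univ, true_and] at hh ⊢
    intro v
    rw [← hh v, levelSet, Set.mem_ofPred_eq, level_vtx γ y x hd, ← add_assoc, sub_add_cancel]
    rfl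

theorem card_injective (n : ℕ) [DecidablePred fun d : Fin 3 → Fin n => Function.Injective d] :
    (univ.filter fun d : Fin 3 → Fin n => Function.Injective d).card = n.descFactorial 3 := by
  rw [← Fintype.card_subtype, Fintype.card_congr (Equiv.subtypeInjectiveEquivEmbedding _ _),
    Fintype.card_embedding_eq, Fintype.card_fin, Fintype.card_fin]

/-- Averaging over all colourings and shifts yields a set with many copies. -/
theorem exists_card_frames_ge (H : Set (Fin 3 → Fin 2)) (γ : ι → G) (A : G → Bool) (n : ℕ) :
    ∃ S : Set (Fin n → Fin 2), (∑ t, goodLocal H γ A t) * (2 ^ n * n.descFactorial 3) ≤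
      Fintype.card G * Fintype.card (Fin 2 × ι) ^ 3 * (frames H S).card := by
  classical
  set Q := ∑ t, goodLocal H γ A t with hQ
  set r := Fintype.card (Fin 2 × ι) with hr
  have key : r ^ 3 * ∑ y : Fin n → Fin 2 × ι, ∑ h : G, (frames H (levelSet γ A h y)).card =
      r ^ n * Q * (2 ^ n * n.descFactorial 3) := by
    have h1 : ∀ (y : Fin n → Fin 2 × ι) (h : G), (frames H (levelSet γ A h y)).card =
        ∑ x : Fin n → Fin 2, ∑ d ∈ univ.filter fun d : Fin 3 → Fin n => Function.Injective d,
          if ∀ v, vtx x d v ∈ levelSet γ A h y ↔ v ∈ H then 1 else 0 := by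
      intro y h
      simp only [frames, Finset.card_filter, Fintype.sum_prod_type, Finset.sum_filter]
      refine Finset.sum_congr rfl fun x _ => Finset.sum_congr rfl fun d _ => ?_
      by_cases hd : Function.Injective d <;> simp [hd]
    simp only [h1]
    have h2 : ∑ y : Fin n → Fin 2 × ι, ∑ h : G, ∑ x : Fin n → Fin 2,
        ∑ d ∈ univ.filter fun d : Fin 3 → Fin n => Function.Injective d,
          (if ∀ v, vtx x d v ∈ levelSet γ A h y ↔ v ∈ H then 1 else 0) =
        ∑ x : Fin n → Fin 2, ∑ d ∈ univ.filter fun d : Fin 3 → Fin n => Function.Injective d,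
          ∑ y : Fin n → Fin 2 × ι,
          (univ.filter fun h : G => ∀ v, vtx x d v ∈ levelSet γ A h y ↔ v ∈ H).card := by
      simp only [Finset.card_filter]
      rw [Finset.sum_congr rfl fun y _ => Finset.sum_comm, Finset.sum_comm]
      refine Finset.sum_congr rfl fun x _ => ?_
      rw [Finset.sum_congr rfl fun y _ => Finset.sum_comm, Finset.sum_comm]
    rw [h2, Finset.mul_sum, Finset.sum_congr rfl fun x _ => by
      rw [Finset.mul_sum, Finset.sum_congr rfl fun d hd =>
        sum_levelSet_eq H γ A x (Finset.mem_filter.1 hd).2]]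
    simp only [Finset.sum_const, card_injective, Finset.card_univ, Fintype.card_pi,
      Fintype.card_fin, Finset.prod_const, smul_eq_mul]
    ring
  -- If every colouring and shift fell below the average, summing would contradict `key`.
  by_contra hcon
  push Not at hcon
  have hlt : ∑ y : Fin n → Fin 2 × ι, ∑ h : G,
      Fintype.card G * r ^ 3 * (frames H (levelSet γ A h y)).card <
      ∑ _y : Fin n → Fin 2 × ι, ∑ _h : G, Q * (2 ^ n * n.descFactorial 3) :=
    Finset.sum_lt_sum_of_nonempty Finset.univ_nonempty fun y _ =>
      Finset.sum_lt_sum_of_nonempty Finset.univ_nonempty fun h _ => hcon _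
  simp only [← Finset.mul_sum] at hlt
  rw [mul_assoc, key] at hlt
  simp only [Finset.sum_const, Finset.card_univ, Fintype.card_pi, Fintype.card_fin,
    Finset.prod_const, smul_eq_mul] at hlt
  rw [← hr] at hlt
  refine absurd hlt (not_lt.2 (le_of_eq ?_))
  ring

end Lower

/-! ### Local patterns as counts inside the group -/

section LocalCount

variable {G ι : Type*} [AddCommGroup G]

/-- The number of shifts for which the colouring `A`, read along the steps `s₀, s₁, s₂`, has the
given mask. -/
def localCount [Fintype G] (mask : ℕ) (A : G → Bool) (s₀ s₁ s₂ : G) : ℕ :=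
  ∑ h : G, cond (matches8 mask (A h) (A (h + s₀)) (A (h + s₁)) (A (h + (s₀ + s₁))) (A (h + s₂))
    (A (h + (s₀ + s₂))) (A (h + (s₁ + s₂))) (A (h + (s₀ + (s₁ + s₂))))) 1 0

/-- The step along a coordinate, which is reversed if the coordinate is reflected. -/
def signed (γ : ι → G) (k : Fin 2 × ι) : G := if k.1 = 0 then γ k.2 else - γ k.2

theorem forall_of_matches8 {mask : ℕ} {t : ℕ → Bool}
    (h : matches8 mask (t 0) (t 1) (t 2) (t 3) (t 4) (t 5) (t 6) (t 7) = true) :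
    ∀ c < 8, t c = mask.testBit c := by
  simp only [matches8, Bool.and_eq_true, beq_iff_eq] at h
  intro c hc
  interval_cases c <;> simp [h]

/-- A reflected coordinate contributes its weight at 0 and loses it at 1: a constant plus a reversed
step. -/
theorem level_eq_signed (γ : ι → G) (t : Fin 3 → Fin 2 × ι) (v : Fin 3 → Fin 2) :
    level γ t v = ∑ a, (t a).1.val • γ (t a).2 + ∑ a, (v a).val • signed γ (t a) := by
  rw [← Finset.sum_add_distrib]
  refine Finset.sum_congr rfl fun a _ => ?_
  unfold signed
  generalize v a = b
  obtain ⟨c, i⟩ := t a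
  fin_cases b <;> fin_cases c <;> simp

variable [Fintype G]

theorem localCount_le_goodLocal {H : Set (Fin 3 → Fin 2)} {mask : ℕ}
    (hH : ∀ c < 8, dec 3 c ∈ H ↔ mask.testBit c = true) (γ : ι → G) (A : G → Bool)
    (t : Fin 3 → Fin 2 × ι) :
    localCount mask A (signed γ (t 0)) (signed γ (t 1)) (signed γ (t 2)) ≤ goodLocal H γ A t := by
  classical
  have hc : ∀ b : Bool, cond b 1 0 = if b = true then 1 else 0 := by decide
  unfold localCount goodLocal
  simp only [hc]
  rw [← Finset.card_filter]
  refine Finset.card_le_card_of_injOn (fun h => h - ∑ a, (t a).1.val • γ (t a).2) ?_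
    fun _ _ _ _ h => sub_left_injective h
  intro h hh
  simp only [Finset.coe_filter, Finset.mem_univ, true_and, Set.mem_ofPred_eq] at hh ⊢
  intro v
  obtain ⟨c, hc, rfl⟩ := dec_surj 3 v
  rw [level_eq_signed, ← add_assoc, sub_add_cancel, hH c hc]
  have hm := forall_of_matches8
    (t := fun c => A (h + ∑ a, (dec 3 c a).val • signed γ (t a))) (mask := mask)
    (by
      rw [← hh]
      simp [Fin.sum_univ_three, dec, Nat.testBit, add_assoc])
  rw [← hm c hc]

theorem sum_localCount_le [AddCommGroup ι] [Fintype ι] {H : Set (Fin 3 → Fin 2)} {mask : ℕ}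
    (hH : ∀ c < 8, dec 3 c ∈ H ↔ mask.testBit c = true) (γ : ι → G) (A : G → Bool) :
    ∑ k₀, ∑ k₁, ∑ k₂, localCount mask A (signed γ k₀) (signed γ k₁) (signed γ k₂) ≤
      ∑ t, goodLocal H γ A t := by
  refine le_trans (le_of_eq ?_)
    (Finset.sum_le_sum fun t _ => localCount_le_goodLocal hH γ A t)
  let e : (Fin 3 → Fin 2 × ι) ≃ (Fin 2 × ι) × (Fin 2 × ι) × (Fin 2 × ι) :=
    { toFun := fun t => (t 0, t 1, t 2)
      invFun := fun k => ![k.1, k.2.1, k.2.2]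
      left_inv := fun t => by
        funext a
        fin_cases a <;> rfl
      right_inv := fun k => rfl }
  rw [← e.symm.sum_comp]
  simp only [Fintype.sum_prod_type]
  rfl

end LocalCount

/-- Five-bit strings under exclusive or. -/
def Xor5 := BitVec 5

namespace Xor5

instance : Zero Xor5 := ⟨0#5⟩

instance : Add Xor5 := ⟨fun a b => BitVec.xor a b⟩

instance : Neg Xor5 := ⟨fun a => a⟩

instance : AddCommGroup Xor5 where
  add_assoc a b c := BitVec.xor_assoc a b c
  zero_add a := BitVec.zero_xor
  add_zero a := BitVec.xor_zero
  add_comm a b := BitVec.xor_comm a b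
  neg_add_cancel a := BitVec.xor_self
  nsmul := nsmulRec
  zsmul := zsmulRec

instance : Fintype Xor5 :=
  Fintype.ofEquiv (Fin 32)
    ⟨fun i => BitVec.ofFin i, fun b => BitVec.toFin b, fun _ => rfl, fun _ => rfl⟩

end Xor5

open Filter

/-! ### The inducibility constants -/

section Limit

theorem card_stabilizer_eq {H : Set (Fin 3 → Fin 2)} (P : (Fin 3 → Fin 2) → Bool)
    (hP : ∀ v, v ∈ H ↔ P v = true) :
    (stabilizer H).card = (univ.filter fun σ : (Fin 3 → Fin 2) × Equiv.Perm (Fin 3) =>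
      ∀ v, P (σ.1 + v ∘ σ.2.symm) = P v).card := by
  congr 1
  ext σ
  simp only [mem_stabilizer, Finset.mem_filter, Finset.mem_univ, true_and, hP]
  exact forall_congr' fun v => Bool.eq_iff_iff.symm

theorem copyCount_le_inducibility {n : ℕ} (H : Set (Fin 3 → Fin 2)) (S : Set (Fin n → Fin 2)) :
    copyCount H S ≤ inducibility H n := by
  classical
  have h := Finset.le_sup (f := fun S : Finset (Fin n → Fin 2) => copyCount H (S : Set (Fin n → Fin 2)))
    (Finset.mem_univ S.toFinset)
  simpa [inducibility] using h

/-- Uses 48 · C(n,3) · 2^(n-3) = 2^n · n(n-1)(n-2). The lower bound is then exactly `c` for every n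
≥ 3, and the upper bound is `c` times n^3 / (n(n-1)(n-2)). -/
theorem hasInducibilityConstant_of_bounds {H : Set (Fin 3 → Fin 2)} {s A B Q q : ℕ} {c : ℝ}
    (hs : (stabilizer H).card = s)
    (hup : ∀ (n : ℕ) (S : Set (Fin n → Fin 2)), A * (frames H S).card ≤ B * (2 ^ n * n ^ 3))
    (hlow : ∀ n : ℕ, ∃ S : Set (Fin n → Fin 2),
      Q * (2 ^ n * n.descFactorial 3) ≤ q * (frames H S).card)
    (hs0 : 0 < s) (hA : 0 < A) (hq : 0 < q)
    (hcA : c * (A * s) = 48 * B) (hcq : c * (q * s) = 48 * Q) :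
    HasInducibilityConstant H c := by
  have hs0' : (0 : ℝ) < s := by exact_mod_cast hs0
  have hA' : (0 : ℝ) < A := by exact_mod_cast hA
  have hq' : (0 : ℝ) < q := by exact_mod_cast hq
  have hD : ∀ n : ℕ, 3 ≤ n →
      48 * ((n.choose 3 : ℝ) * 2 ^ (n - 3)) = 2 ^ n * n.descFactorial 3 := by
    intro n hn
    have h2 : (2 : ℝ) ^ n = 2 ^ (n - 3) * 8 := by
      conv_lhs => rw [← Nat.sub_add_cancel hn, pow_add]
      norm_num
    rw [h2, Nat.descFactorial_eq_factorial_mul_choose]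
    push_cast [Nat.factorial]
    ring
  have hlim : Tendsto (fun n : ℕ => c * ((n : ℝ) ^ 3 / n.descFactorial 3)) atTop (nhds c) := by
    have h := (Asymptotics.isEquivalent_iff_tendsto_one ?_).1 (isEquivalent_descFactorial 3).symm
    · simpa using h.const_mul c
    · filter_upwards [eventually_ge_atTop 3] with n hn
      exact_mod_cast (Nat.descFactorial_pos.2 hn).ne'
  unfold HasInducibilityConstant
  refine tendsto_of_tendsto_of_tendsto_of_le_of_le' tendsto_const_nhds hlim ?_ ?_
  · filter_upwards [eventually_ge_atTop 3] with n hn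
    have hpos : (0 : ℝ) < (n.choose 3 : ℝ) * 2 ^ (n - 3) := by
      have := Nat.choose_pos hn
      positivity
    rw [le_div_iff₀ hpos]
    obtain ⟨S, hS⟩ := hlow n
    rw [card_frames, hs] at hS
    have h1 : (Q : ℝ) * (2 ^ n * n.descFactorial 3) ≤ q * (s * copyCount H S) := by
      exact_mod_cast hS
    have h2 : (copyCount H S : ℝ) ≤ inducibility H n := by
      exact_mod_cast copyCount_le_inducibility H S
    rw [← hD n hn] at h1
    refine le_trans ?_ h2
    refine le_of_mul_le_mul_left ?_ (mul_pos hq' hs0')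
    calc (q * s : ℝ) * (c * ((n.choose 3 : ℝ) * 2 ^ (n - 3)))
        = c * (q * s) * ((n.choose 3 : ℝ) * 2 ^ (n - 3)) := by ring
      _ = Q * (48 * ((n.choose 3 : ℝ) * 2 ^ (n - 3))) := by
        rw [hcq]
        ring
      _ ≤ q * (s * copyCount H S) := h1
      _ = _ := by ring
  · filter_upwards [eventually_ge_atTop 3] with n hn
    have hpos : (0 : ℝ) < (n.choose 3 : ℝ) * 2 ^ (n - 3) := by
      have := Nat.choose_pos hn
      positivity
    have hd : (0 : ℝ) < n.descFactorial 3 := by exact_mod_cast Nat.descFactorial_pos.2 hn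
    obtain ⟨S, -, hS⟩ := Finset.exists_mem_eq_sup (Finset.univ : Finset (Finset (Fin n → Fin 2)))
      Finset.univ_nonempty fun S => copyCount H (S : Set (Fin n → Fin 2))
    have hI : inducibility H n = copyCount H (S : Set (Fin n → Fin 2)) := hS
    have h1 := hup n S
    rw [card_frames, hs, ← hI] at h1
    have h2 : (A * (s * inducibility H n) : ℝ) ≤ B * (2 ^ n * n ^ 3) := by exact_mod_cast h1
    rw [div_le_iff₀ hpos]
    refine le_of_mul_le_mul_left ?_ (mul_pos hA' hs0')
    calc (A * s : ℝ) * inducibility H n = A * (s * inducibility H n) := by ring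
      _ ≤ B * (2 ^ n * n ^ 3) := h2
      _ = B * ((n : ℝ) ^ 3 / n.descFactorial 3) * (2 ^ n * n.descFactorial 3) := by
        field_simp
      _ = (48 * B) * (((n : ℝ) ^ 3 / n.descFactorial 3) *
          ((n.choose 3 : ℝ) * 2 ^ (n - 3))) := by
        rw [← hD n hn]
        ring
      _ = _ := by
        rw [← hcA]
        ring

end Limit

/-! ### Masks, symmetry groups, constructions and certificates for the five configurations -/

section Configurations

theorem mem_W7 (v : Fin 3 → Fin 2) : v ∈ W7 ↔ v = ![0, 0, 0] ∨ v = ![1, 1, 1] := Iff.rfl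

theorem mem_W8 (v : Fin 3 → Fin 2) :
    v ∈ W8 ↔ v = ![0, 0, 1] ∨ v = ![0, 1, 0] ∨ v = ![1, 0, 0] := Iff.rfl

theorem mem_W9 (v : Fin 3 → Fin 2) :
    v ∈ W9 ↔ v = ![0, 0, 0] ∨ v = ![0, 0, 1] ∨ v = ![0, 1, 0] ∨ v = ![1, 1, 1] := Iff.rfl

theorem mem_W10 (v : Fin 3 → Fin 2) :
    v ∈ W10 ↔ v = ![0, 0, 0] ∨ v = ![0, 0, 1] ∨ v = ![1, 1, 1] := Iff.rfl

theorem mem_W12 (v : Fin 3 → Fin 2) :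
    v ∈ W12 ↔ v = ![0, 0, 0] ∨ v = ![0, 0, 1] ∨ v = ![0, 1, 0] ∨ v = ![1, 0, 0] := Iff.rfl

theorem mask_W7 : ∀ c < 8, dec 3 c ∈ W7 ↔ Nat.testBit 129 c = true := by
  simp only [mem_W7]
  decide

theorem mask_W8 : ∀ c < 8, dec 3 c ∈ W8 ↔ Nat.testBit 22 c = true := by
  simp only [mem_W8]
  decide

theorem mask_W9 : ∀ c < 8, dec 3 c ∈ W9 ↔ Nat.testBit 149 c = true := by
  simp only [mem_W9]
  decide

theorem mask_W10 : ∀ c < 8, dec 3 c ∈ W10 ↔ Nat.testBit 145 c = true := by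
  simp only [mem_W10]
  decide

theorem mask_W12 : ∀ c < 8, dec 3 c ∈ W12 ↔ Nat.testBit 23 c = true := by
  simp only [mem_W12]
  decide

theorem card_stabilizer_W7 : (stabilizer W7).card = 12 := by
  rw [card_stabilizer_eq (fun v => decide (v = ![0, 0, 0] ∨ v = ![1, 1, 1])) (by simp [mem_W7])]
  decide +kernel

theorem card_stabilizer_W8 : (stabilizer W8).card = 6 := by
  rw [card_stabilizer_eq (fun v => decide (v = ![0, 0, 1] ∨ v = ![0, 1, 0] ∨ v = ![1, 0, 0]))
    (by simp [mem_W8])]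
  decide +kernel

theorem card_stabilizer_W9 : (stabilizer W9).card = 2 := by
  rw [card_stabilizer_eq (fun v => decide (v = ![0, 0, 0] ∨ v = ![0, 0, 1] ∨ v = ![0, 1, 0] ∨
    v = ![1, 1, 1])) (by simp [mem_W9])]
  decide +kernel

theorem card_stabilizer_W10 : (stabilizer W10).card = 2 := by
  rw [card_stabilizer_eq (fun v => decide (v = ![0, 0, 0] ∨ v = ![0, 0, 1] ∨ v = ![1, 1, 1]))
    (by simp [mem_W10])]
  decide +kernel

theorem card_stabilizer_W12 : (stabilizer W12).card = 6 := by
  rw [card_stabilizer_eq (fun v => decide (v = ![0, 0, 0] ∨ v = ![0, 0, 1] ∨ v = ![0, 1, 0] ∨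
    v = ![1, 0, 0])) (by simp [mem_W12])]
  decide +kernel

/-- A lower bound from a colouring of a finite abelian group. -/
theorem exists_card_frames_ge_of_localCount {G ι : Type*} [AddCommGroup G] [AddCommGroup ι]
    [Fintype G] [Fintype ι] {H : Set (Fin 3 → Fin 2)} {mask Q q : ℕ}
    (hH : ∀ c < 8, dec 3 c ∈ H ↔ mask.testBit c = true) (γ : ι → G) (A : G → Bool)
    (hQ : ∑ k₀, ∑ k₁, ∑ k₂, localCount mask A (signed γ k₀) (signed γ k₁) (signed γ k₂) = Q)
    (hq : Fintype.card G * Fintype.card (Fin 2 × ι) ^ 3 = q) (n : ℕ) :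
    ∃ S : Set (Fin n → Fin 2),
      Q * (2 ^ n * n.descFactorial 3) ≤ q * (frames H S).card := by
  obtain ⟨S, hS⟩ := exists_card_frames_ge H γ A n
  refine ⟨S, le_trans (Nat.mul_le_mul_right _ ?_) (hq ▸ hS)⟩
  exact hQ ▸ sum_localCount_le hH γ A

/-- One layer in three. A cube with all three steps in the same direction shows `W7` or `W8`,
depending on the layer of its lowest vertex. -/
def weight3 (_ : Fin 1) : ZMod 3 := 1

def level3 (g : ZMod 3) : Bool := decide (g = 1)

def weight4 (_ : Fin 1) : ZMod 4 := 1

def level4 (g : ZMod 4) : Bool := decide (g = 0 ∨ g = 1)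

/-- Listing `(0, 1)` twice gives it probability 2/3. Every 3-subcube with exactly one coordinate of
weight `(1, 0)` is a copy of `W9`, and 3 · (1/3) · (2/3)^2 = 4/9. -/
def weight24 : Fin 3 → ZMod 2 × ZMod 4 := ![(1, 0), (0, 1), (0, 1)]

def level24 (g : ZMod 2 × ZMod 4) : Bool :=
  decide (g = (0, 0) ∨ g = (0, 1) ∨ g = (1, 2) ∨ g = (1, 3))

def weightXor : Fin 6 → Xor5 := ![1#5, 2#5, 4#5, 8#5, 16#5, 31#5]

/-- The characteristic function of
`{0, 1, 6, 10, 13, 15, 19, 20, 23, 25, 26, 28}`, a set in which every element has one neighbour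
and every other string has three neighbours, for the Cayley graph given by `weightXor`. -/
def levelXor (g : Xor5) : Bool := Nat.testBit 379102275 (BitVec.toNat g)

/-- Reflections do nothing in a group of exponent 2, whence the factor 8 in 960 = 8 · 120. Three
weights are distinct with probability 5/9, and 60 of the 80 resulting cubes in the group are copies,
giving 5/9 · 3/4 = 5/12. -/
theorem sum_localCount_Xor : ∑ k₀, ∑ k₁, ∑ k₂, localCount 145 levelXor (signed weightXor k₀)
    (signed weightXor k₁) (signed weightXor k₂) = 960 := by
  have hsig : ∀ k : Fin 2 × Fin 6, signed weightXor k = weightXor k.2 := fun k => ite_self _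
  have h : ∑ i, ∑ j, ∑ k, localCount 145 levelXor (weightXor i) (weightXor j) (weightXor k) =
      120 := by
    decide +kernel
  simp only [hsig, Fintype.sum_prod_type, Finset.sum_const, Finset.card_univ, Fintype.card_fin,
    ← Finset.smul_sum, h]
  rfl

theorem hasInducibilityConstant_W7 : HasInducibilityConstant W7 (1 / 3) :=
  hasInducibilityConstant_of_bounds card_stabilizer_W7
    (fun _ S => card_frames_le_of_certCheck (A := 12) (B := 1) (C := 100)
      -- In the extremal set the root edge joins levels 0 and 2, and a further step puts exactly one
      -- end in `S`: one end if it goes up, the other if down. These balance, so the square vanishes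
      -- there, as tightness requires.
      (Qs := [⟨4, (false, false), (0, 1, -1, 0)⟩]) mask_W7 (by decide +kernel) S)
    (exists_card_frames_ge_of_localCount (Q := 2) (q := 24) mask_W7 weight3 level3
      (by decide +kernel) rfl)
    (by norm_num) (by norm_num) (by norm_num) (by norm_num) (by norm_num)

theorem hasInducibilityConstant_W8 : HasInducibilityConstant W8 (2 / 3) :=
  hasInducibilityConstant_of_bounds card_stabilizer_W8
    (A := 12) (B := 1)
    (fun n S => (card_frames_star_le mask_W8 S).trans_eq (one_mul _).symm)
    (exists_card_frames_ge_of_localCount (Q := 2) (q := 24) mask_W8 weight3 level3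
      (by decide +kernel) rfl)
    (by norm_num) (by norm_num) (by norm_num) (by norm_num) (by norm_num)

theorem hasInducibilityConstant_W9 : HasInducibilityConstant W9 (4 / 9) :=
  hasInducibilityConstant_of_bounds card_stabilizer_W9
    (fun _ S => card_frames_le_of_certCheck (A := 864) (B := 16) (C := 1000)
      (Qs := [⟨7, (false, false), (1, 2, 2, -4)⟩, ⟨8, (true, false), (1, 4, -2, 1)⟩,
        ⟨7, (true, true), (-4, 2, 2, 1)⟩]) mask_W9 (by decide +kernel) S)
    (exists_card_frames_ge_of_localCount (Q := 32) (q := 1728) mask_W9 weight24 level24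
      (by decide +kernel) rfl)
    (by norm_num) (by norm_num) (by norm_num) (by norm_num) (by norm_num)

theorem hasInducibilityConstant_W10 : HasInducibilityConstant W10 (5 / 12) :=
  hasInducibilityConstant_of_bounds card_stabilizer_W10
    (fun _ S => card_frames_le_of_certCheck (A := 1440) (B := 25) (C := 1000)
      (Qs := [⟨25, (false, false), (1, 0, 0, -1)⟩, ⟨9, (false, false), (0, 1, 1, -4)⟩,
        ⟨136, (false, false), (0, 1, -1, 0)⟩, ⟨1, (true, true), (1, 0, 0, -5)⟩,
        ⟨2, (true, false), (7, 1, -5, -4)⟩, ⟨52, (true, false), (1, -2, 0, 0)⟩])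
      mask_W10 (by decide +kernel) S)
    (exists_card_frames_ge_of_localCount (Q := 960) (q := 55296) mask_W10 weightXor levelXor
      sum_localCount_Xor (by decide +kernel))
    (by norm_num) (by norm_num) (by norm_num) (by norm_num) (by norm_num)

theorem hasInducibilityConstant_W12 : HasInducibilityConstant W12 (1 / 2) :=
  hasInducibilityConstant_of_bounds card_stabilizer_W12
    (fun _ S => card_frames_le_of_certCheck (A := 16) (B := 1) (C := 100)
      -- In the extremal set a further step along a boundary edge leads to two vertices outside `S`
      -- or two inside, depending on its sign, so the values 1 and -1 balance.
      (Qs := [⟨4, (true, false), (1, 0, 0, -1)⟩]) mask_W12 (by decide +kernel) S)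
    (exists_card_frames_ge_of_localCount (Q := 2) (q := 32) mask_W12 weight4 level4
      (by decide +kernel) rfl)
    (by norm_num) (by norm_num) (by norm_num) (by norm_num) (by norm_num)

end Configurations

end Hypercube

theorem theorem1 :
    Hypercube.HasInducibilityConstant Hypercube.W7 (1 / 3) ∧
    Hypercube.HasInducibilityConstant Hypercube.W8 (2 / 3) ∧
    Hypercube.HasInducibilityConstant Hypercube.W9 (4 / 9) ∧
    Hypercube.HasInducibilityConstant Hypercube.W10 (5 / 12) ∧
    Hypercube.HasInducibilityConstant Hypercube.W12 (1 / 2) :=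
  ⟨Hypercube.hasInducibilityConstant_W7, Hypercube.hasInducibilityConstant_W8,
    Hypercube.hasInducibilityConstant_W9, Hypercube.hasInducibilityConstant_W10,
    Hypercube.hasInducibilityConstant_W12⟩
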